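/- **Setting.** Let $d\ge 1$ be an integer, $p$ an odd prime, $\mathcal H$ the upper half-plane, $\Omega(\mathcal H)$ the space of holomorphic functions $\mathcal H\to\mathbb C$, and $Q(x,y)=\sum_i x_iy_i$. Square roots are principal. In $\mathrm{GL}_2(\mathbb Z[\tfrac12])$ let $\alpha=\begin{pmatrix}1&1\\0&1\end{pmatrix}$, $\gamma=\begin{pmatrix}0&1\\-4&0\end{pmatrix}$, $\Lambda=\langle\alpha,\gamma\rangle$, and let $\Delta$ be the subgroup of matrices with lower left entry in $p\mathbb Z[\tfrac12]$ and determinant in $4^{\mathbb Z}$. The group $\Lambda$ acts on $\mathcal H$ by Möbius transformations and on $X=\mathbb P^1(\mathbb F_p)=\mathbb F_p\cup\{\infty\}$ through reduction modulo $p$. For a group $G$ acting on a set $Y$, a map $\varphi:G\times Y\to H$ is a *cocycle* if $\varphi(g_1g_2,y)=\varphi(g_1,g_2y)\varphi(g_2,y)$. Let $\bar h:\Lambda\times\mathcal H\to\mathbb C$ be the unique cocycle with $\bar h(\alpha,\tau)=1$ and $\bar h(\gamma,\tau)=\sqrt{-4\tau}$ (it exists, is holomorphic in $\tau$, and $\bar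 h(g,\tau)^2=c\tau+e$ if $(c,e)$ is the lower row of $g$). For $u\in\mathbb C$ the formula $$([\tilde g]_{d/2,u}\psi)(\tau)=\bar h(g^{-1},\tau)^{-d}\,(\det g)^{-u}\,\psi(g^{-1}\tau)$$ defines an action of $\Lambda$ on $\Omega(\mathcal H)$. Let $V_p$ be the space of even functions $f:(\mathbb Z/p\mathbb Z)^d\to\mathbb C$ and $\mathcal F(f)(\xi)=\sum_x f(x)e^{-2\pi iQ(x,\xi)/p}$. For $f\in V_p$ and $\tau\in\mathcal H$ put $$\theta_f^j(\tau)=\sum_{x\in\mathbb Z^d}f(x)\,e^{2\pi iQ(x,x)(\tau-j)/p^2}\quad(0\le j\le p-1),\qquad \theta_f^\infty(\tau)=\sum_{x\in\mathbb Z^d}\mathcal F(f)(x)\,e^{2\pi iQ(x,x)\tau}.$$ In $\mathrm{GL}(V_p)$ let $(Lf)(x)=e^{-2\pi iQ(x,x)/p}f(x)$ and $(S_af)(x)=f(ax)$ for $a\in\mathbb F_p^*$. For $1\le j\le p-1$ let $j'\in\{1,\dots,p-1\}$ be the element with $p\mid 4jj'+1$, and $k_j=(4jj'+1)/p$. **Theorem.**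 The series $\theta_f^j(\tau)$ converge absolutely and $\theta_f^j\in\Omega(\mathcal H)$. There exist a cocycle $\tilde\varphi:\Lambda\times X\to\Delta$, a linear representation $\pi_\Delta:\Delta\to\mathrm{GL}(V_p)$ and $u\in\mathbb C$ such that $\sigma=\pi_\Delta\circ\tilde\varphi:\Lambda\times X\to\mathrm{GL}(V_p)$ is a cocycle and the following hold. 1. For all $g\in\Lambda$, $j\in X$, $f\in V_p$: $\;[\tilde g]_{d/2,u}\,\theta_f^j=\theta^{\,g\cdot j}_{\sigma(g,j)f}$. 2. $\sigma(\alpha,j)=1$ for $0\le j\le p-2$, $\sigma(\alpha,p-1)=L$, $\sigma(\alpha,\infty)=1$; $\sigma(\gamma,0)=1$, $\sigma(\gamma,j)=S_{-2j'}L^{-k_jj}$ for $1\le j\le p-1$, $\sigma(\gamma,\infty)=1$. 3. $\tilde\varphi(\alpha,j)=1$ for $0\le j\le p-2$, $\tilde\varphi(\alpha,p-1)=\begin{pmatrix}1&-4\\0&1\end{pmatrix}$, $\tilde\varphi(\alpha,\infty)=\begin{pmatrix}1&0\\p&1\end{pmatrix}$; $\tilde\varphi(\gamma,0)=\begin{pmatrix}-4&0\\0&-4\end{pmatrix}$,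 $\tilde\varphi(\gamma,j)=\begin{pmatrix}4j'&-4k_j\\p&-4j\end{pmatrix}$ for $1\le j\le p-1$, $\tilde\varphi(\gamma,\infty)=1$. 4. Let $\Lambda$ act on the space $V_p^X$ of functions $F:X\to V_p$ by the linear representation $(g\cdot F)(j)=\sigma(g,g^{-1}j)F(g^{-1}j)$. This representation is induced from the stabilizer $\Lambda_\infty$ of $\infty\in X$ acting on $W_\infty=\{F: F(i)=0 \text{ for } i\ne\infty\}$: the subspace $W_\infty$ is $\Lambda_\infty$-stable and $V_p^X$ is the direct sum of its translates over $\Lambda/\Lambda_\infty$. The linear map $\Theta:V_p^X\to\Omega(\mathcal H)$, $\Theta(F)=\sum_{j\in X}\theta^j_{F(j)}$, satisfies $[\tilde g]_{d/2,u}\,\Theta(F)=\Theta(g\cdot F)$ for all $g\in\Lambda$ and $F\in V_p^X$. -/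

import Mathlib

open UpperHalfPlane OnePoint
open scoped Manifold

noncomputable section

/-! ### Cocycles, the representation defined by a cocycle, induced representations -/

/-- A cocycle on `X` for the action of `G`, with values in `H` (also used for `H = ℂ`). -/
def IsCocycle {G X H : Type*} [Group G] [MulAction G X] [Mul H] (φ : G → X → H) : Prop :=
  ∀ (g₁ g₂ : G) (x : X), φ (g₁ * g₂) x = φ g₁ (g₂ • x) * φ g₂ x

theorem IsCocycle.map_one {G X H : Type*} [Group G] [MulAction G X] [Group H] {φ : G → X → H}
    (h : IsCocycle φ) (x : X) : φ 1 x = 1 := by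
  have := h 1 1 x
  simpa using this

/-- The representation of `G` on `V`-valued functions on `X` defined by a `GL(V)`-valued cocycle,
`(g • F)(x) = σ(g, g⁻¹ x) F(g⁻¹ x)`. -/
def cocycleRep {G X V : Type*} [Group G] [MulAction G X] [AddCommGroup V] [Module ℂ V]
    (σ : G → X → LinearMap.GeneralLinearGroup ℂ V) (hσ : IsCocycle σ) :
    Representation ℂ G (X → V) where
  toFun g :=
    { toFun := fun F x => (σ g (g⁻¹ • x) : V →ₗ[ℂ] V) (F (g⁻¹ • x))
      map_add' := fun F₁ F₂ => by ext x; simp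
      map_smul' := fun c F => by ext x; simp }
  map_one' := by
    ext F x
    simp [hσ.map_one]
  map_mul' g₁ g₂ := by
    refine LinearMap.ext fun F => funext fun x => ?_
    have h : (g₁ * g₂)⁻¹ • x = g₂⁻¹ • g₁⁻¹ • x := by rw [mul_inv_rev, mul_smul]
    simp only [LinearMap.coe_mk, AddHom.coe_mk, h, Module.End.mul_apply]
    rw [hσ, smul_inv_smul]
    rfl

open scoped Classical in
/-- A representation `ρ` of `G` on `E` is induced by the subspace `W`, stable under the
subgroup `H`, if `E` is the direct sum of the translates `ρ(s) W`, where `s` runs through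
representatives of the left cosets `s H`. -/
def IsInducedFrom {G E : Type*} [Group G] [AddCommGroup E] [Module ℂ E]
    (ρ : Representation ℂ G E) (H : Subgroup G) (W : Submodule ℂ E) : Prop :=
  (∀ h ∈ H, ∀ w ∈ W, ρ h w ∈ W) ∧
    DirectSum.IsInternal fun c : G ⧸ H => W.map (ρ c.out)

/-- The functions on `X` that vanish outside the point `x`. -/
def supportedAt {X V : Type*} [AddCommGroup V] [Module ℂ V] (x : X) :
    Submodule ℂ (X → V) where
  carrier := {F | ∀ y, y ≠ x → F y = 0}
  add_mem' := fun ha hb y hy => by simp [ha y hy, hb y hy]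
  zero_mem' := fun y _ => rfl
  smul_mem' := fun c F hF y hy => by simp [hF y hy]

/-! ### The group `Λ` and its actions -/

/-- The ring `ℤ[1/2]`. -/
abbrev ZHalf : Type := Localization.Away (2 : ℤ)

/-- The element `1/2` of `ℤ[1/2]`. -/
def ZHalf.half : ZHalf := IsLocalization.Away.invSelf (2 : ℤ)

theorem ZHalf.two_mul_half : (2 : ZHalf) * ZHalf.half = 1 := by
  have := IsLocalization.Away.mul_invSelf (S := ZHalf) (2 : ℤ)
  rwa [map_ofNat] at this

/-- The unit `4` of `ℤ[1/2]`. -/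
def ZHalf.four : ZHalfˣ where
  val := 4
  inv := ZHalf.half * ZHalf.half
  val_inv := by linear_combination (2 * ZHalf.half + 1) * ZHalf.two_mul_half
  inv_val := by linear_combination (2 * ZHalf.half + 1) * ZHalf.two_mul_half

/-- The inclusion of `ℤ[1/2]` in `ℝ`. -/
def ZHalf.toReal : ZHalf →+* ℝ :=
  IsLocalization.Away.lift (2 : ℤ) (g := Int.castRingHom ℝ) (by simp)

theorem isUnit_two_zmod (p : ℕ) [Fact p.Prime] [hp : Fact (p ≠ 2)] :
    IsUnit (Int.castRingHom (ZMod p) 2) := by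
  rw [isUnit_iff_ne_zero]
  intro h
  have h2 : ((2 : ℕ) : ZMod p) = 0 := by simpa using h
  rw [ZMod.natCast_eq_zero_iff] at h2
  exact hp.out ((Nat.prime_dvd_prime_iff_eq Fact.out Nat.prime_two).1 h2)

/-- Reduction modulo the odd prime `p`, from `ℤ[1/2]` to `ℤ/pℤ`. -/
def ZHalf.toZMod (p : ℕ) [Fact p.Prime] [Fact (p ≠ 2)] : ZHalf →+* ZMod p :=
  IsLocalization.Away.lift (2 : ℤ) (isUnit_two_zmod p)

/-- The action of `GL₂(ℤ[1/2])` on the upper half plane. On matrices of positive determinant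
(for example all elements of `Λ`) it is `τ ↦ (aτ + b) / (cτ + d)`. -/
instance : MulAction (GL (Fin 2) ZHalf) ℍ :=
  MulAction.compHom ℍ (Matrix.GeneralLinearGroup.map (n := Fin 2) ZHalf.toReal)

/-- The action of `GL₂(ℤ[1/2])` on `ℙ¹(𝔽_p) = 𝔽_p ∪ {∞}`. -/
instance (p : ℕ) [Fact p.Prime] [Fact (p ≠ 2)] :
    MulAction (GL (Fin 2) ZHalf) (OnePoint (ZMod p)) :=
  MulAction.compHom (OnePoint (ZMod p))
    (Matrix.GeneralLinearGroup.map (n := Fin 2) (ZHalf.toZMod p))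

/-- The matrix `(1 1; 0 1)`. -/
def matAlpha : GL (Fin 2) ZHalf := .mk'' !![1, 1; 0, 1] (by simp)

/-- The matrix `(0 1; -4 0)`. -/
def matGamma : GL (Fin 2) ZHalf :=
  .mk'' !![0, 1; -4, 0] (by
    have h : (!![0, 1; -4, 0] : Matrix (Fin 2) (Fin 2) ZHalf).det = ZHalf.four := by
      simp [Matrix.det_fin_two, ZHalf.four]
    exact h ▸ ZHalf.four.isUnit)

/-- The group `Λ` generated by the two matrices. -/
def Lam : Subgroup (GL (Fin 2) ZHalf) := Subgroup.closure {matAlpha, matGamma}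

/-- `(1 1; 0 1)` as an element of `Λ`. -/
def lamAlpha : Lam := ⟨matAlpha, Subgroup.subset_closure (by simp)⟩

/-- `(0 1; -4 0)` as an element of `Λ`. -/
def lamGamma : Lam := ⟨matGamma, Subgroup.subset_closure (by simp)⟩

/-- The real determinant of an element of `Λ`. -/
def realDet (g : Lam) : ℝ := ZHalf.toReal (Matrix.det (g : GL (Fin 2) ZHalf).val)

/-- The group `Δ` of the matrices in `GL₂(ℤ[1/2])` with lower left entry in `p ℤ[1/2]` and
determinant a power of `4`. -/
def Del (p : ℕ) : Subgroup (GL (Fin 2) ZHalf) where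
  carrier := {g | (∃ c : ZHalf, g 1 0 = p * c) ∧
    ∃ n : ℤ, Matrix.GeneralLinearGroup.det g = ZHalf.four ^ n}
  mul_mem' := by
    rintro g h ⟨⟨c, hc⟩, n, hn⟩ ⟨⟨c', hc'⟩, n', hn'⟩
    refine ⟨⟨c * h 0 0 + g 1 1 * c', ?_⟩, n + n', ?_⟩
    · simp only [Matrix.GeneralLinearGroup.coe_mul, Matrix.mul_apply, Fin.sum_univ_two, hc, hc']
      ring
    · rw [map_mul, hn, hn', zpow_add]
  one_mem' := ⟨⟨0, by simp⟩, 0, by simp⟩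
  inv_mem' := by
    rintro g ⟨⟨c, hc⟩, n, hn⟩
    refine ⟨⟨-(Ring.inverse (Matrix.det g.val) * c), ?_⟩, -n, ?_⟩
    · simp only [Matrix.coe_units_inv, Matrix.inv_def, Matrix.adjugate_fin_two,
        Matrix.smul_apply, smul_eq_mul]
      simp [hc]
      ring
    · rw [map_inv, hn, zpow_neg]

/-! ### The half-integral weight factor of automorphy -/

/-- `h : Λ × ℍ → ℂ` is a cocycle with `h(α, τ) = 1` and `h(γ, τ) = √(-4τ)`
(principal square root). -/
structure IsHalfFactor (h : Lam → ℍ → ℂ) : Prop where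
  cocycle : IsCocycle h
  alpha : ∀ τ : ℍ, h lamAlpha τ = 1
  gamma : ∀ τ : ℍ, h lamGamma τ = (-4 * (τ : ℂ)) ^ (1 / 2 : ℂ)


theorem matAlpha_val : matAlpha.val = !![1, 1; 0, 1] := rfl

theorem matGamma_val : matGamma.val = !![0, 1; -4, 0] := rfl

theorem realDet_mul (g h : Lam) : realDet (g * h) = realDet g * realDet h := by
  simp [realDet]

theorem realDet_one : realDet 1 = 1 := by simp [realDet]

theorem realDet_alpha : realDet lamAlpha = 1 := by
  simp [realDet, lamAlpha, matAlpha_val, Matrix.det_fin_two]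

theorem realDet_gamma : realDet lamGamma = 4 := by
  simp [realDet, lamGamma, matGamma_val, Matrix.det_fin_two, map_ofNat ZHalf.toReal]

/-- Induction principle for `Λ`. -/
theorem lam_induction {P : Lam → Prop} (ha : P lamAlpha) (hg : P lamGamma) (h1 : P 1)
    (hm : ∀ x y, P x → P y → P (x * y)) (hi : ∀ x, P x → P x⁻¹) (g : Lam) : P g := by
  obtain ⟨g, hgm⟩ := g
  refine Subgroup.closure_induction (p := fun x hx => P ⟨x, hx⟩) ?_ h1
    (fun x y hx hy h h' => hm ⟨x, hx⟩ ⟨y, hy⟩ h h') (fun x hx h => hi ⟨x, hx⟩ h) hgm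
  rintro x (rfl | rfl)
  · exact ha
  · exact hg

theorem realDet_pos (g : Lam) : 0 < realDet g := by
  refine lam_induction (P := fun g => 0 < realDet g) ?_ ?_ ?_ ?_ ?_ g
  · simp [realDet_alpha]
  · simp [realDet_gamma]
  · simp [realDet_one]
  · intro x y hx hy
    rw [realDet_mul]
    positivity
  · intro x hx
    have : realDet x⁻¹ * realDet x = 1 := by rw [← realDet_mul, inv_mul_cancel, realDet_one]
    nlinarith [this, hx]

/-- An element of `Λ` as a real matrix. -/
def lamReal (g : Lam) : GL (Fin 2) ℝ :=
  Matrix.GeneralLinearGroup.map (n := Fin 2) ZHalf.toReal (g : GL (Fin 2) ZHalf)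

theorem lam_smul_def (g : Lam) (τ : ℍ) : g • τ = lamReal g • τ := rfl

theorem lamReal_det (g : Lam) : (lamReal g).det.val = realDet g := by
  simp [lamReal, realDet, RingHom.map_det]

theorem lam_mdiff (g : Lam) : MDifferentiable 𝓘(ℂ) 𝓘(ℂ) (fun τ : ℍ => g • τ) := by
  have : 0 < (lamReal g).det.val := by rw [lamReal_det]; exact realDet_pos g
  exact mdifferentiable_smul this

theorem coe_lamAlpha_smul (τ : ℍ) : ((lamAlpha • τ : ℍ) : ℂ) = τ + 1 := by
  have : 0 < (lamReal lamAlpha).det.val := by rw [lamReal_det]; exact realDet_pos _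
  rw [lam_smul_def, coe_smul_of_det_pos this]
  simp [num, denom, lamReal, lamAlpha, matAlpha_val]

theorem coe_lamGamma_smul (τ : ℍ) : ((lamGamma • τ : ℍ) : ℂ) = 1 / (-4 * τ) := by
  have : 0 < (lamReal lamGamma).det.val := by rw [lamReal_det]; exact realDet_pos _
  rw [lam_smul_def, coe_smul_of_det_pos this]
  simp [num, denom, lamReal, lamGamma, matGamma_val, map_ofNat ZHalf.toReal]


/-- The theta series `∑ₙ exp(2πi n² τ)`, used to construct the factor of automorphy. -/
def thetaAux (τ : ℍ) : ℂ := jacobiTheta (2 * τ)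

theorem thetaAux_mdiff : MDifferentiable 𝓘(ℂ) 𝓘(ℂ) thetaAux := by
  rw [UpperHalfPlane.mdifferentiable_iff]
  intro z hz
  have hz' : 0 < (2 * z).im := by simpa using hz
  have h1 : DifferentiableAt ℂ (fun z : ℂ => jacobiTheta (2 * z)) z :=
    (differentiableAt_jacobiTheta hz').comp z (by fun_prop)
  refine (h1.differentiableWithinAt).congr (fun w hw => ?_) ?_
  · simp [thetaAux, ofComplex_apply_of_im_pos hw]
  · simp [thetaAux, ofComplex_apply_of_im_pos hz]

theorem thetaAux_ne_zero : thetaAux ≠ 0 := by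
  intro h
  have h0 : jacobiTheta (2 * UpperHalfPlane.I) = 0 := congrFun h UpperHalfPlane.I
  have him : (0 : ℝ) < (2 * (UpperHalfPlane.I : ℂ)).im := by simp
  have := norm_jacobiTheta_sub_one_le him
  rw [h0] at this
  have him2 : (2 * (UpperHalfPlane.I : ℂ)).im = 2 := by simp
  rw [him2] at this
  have hx : Real.exp (-Real.pi * 2) < 1 / 4 := by
    have : Real.exp (-Real.pi * 2) ≤ Real.exp (-2) := by
      apply Real.exp_le_exp.2
      nlinarith [Real.pi_gt_three]
    have h2 : Real.exp (-2) = (Real.exp 1)⁻¹ * (Real.exp 1)⁻¹ := by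
      rw [← Real.exp_neg, ← Real.exp_add]; norm_num
    have h3 : (Real.exp 1)⁻¹ < 1 / 2 := by
      rw [inv_lt_comm₀ (Real.exp_pos 1) (by norm_num)]
      have := Real.exp_one_gt_d9
      norm_num
      linarith
    have h4 : 0 < (Real.exp 1)⁻¹ := by positivity
    nlinarith
  have hpos := Real.exp_pos (-Real.pi * 2)
  set x := Real.exp (-Real.pi * 2)
  have : (1 : ℝ) ≤ 2 / (1 - x) * x := by simpa using this
  rw [div_mul_eq_mul_div, le_div_iff₀ (by linarith)] at this
  linarith

/-- A character of `Λ`, trivial on `α`, used to construct the factor of automorphy. -/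
def auxChar (g : Lam) : ℂ :=
  Complex.exp (Real.log (realDet g) * (Complex.log (Complex.I / 2) * (1 / 2) / Real.log 4))

theorem auxChar_mul (g h : Lam) : auxChar (g * h) = auxChar g * auxChar h := by
  rw [auxChar, realDet_mul, Real.log_mul (realDet_pos g).ne' (realDet_pos h).ne',
    auxChar, auxChar, ← Complex.exp_add]
  push_cast
  ring_nf

theorem auxChar_ne_zero (g : Lam) : auxChar g ≠ 0 := Complex.exp_ne_zero _

theorem thetaAux_alpha (τ : ℍ) : thetaAux (lamAlpha • τ) = auxChar lamAlpha * 1 * thetaAux τ := by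
  have : auxChar lamAlpha = 1 := by simp [auxChar, realDet_alpha]
  rw [this, thetaAux, thetaAux, coe_lamAlpha_smul, mul_add, mul_one, add_comm,
    jacobiTheta_two_add, one_mul, one_mul]

theorem cpow_gamma (τ : ℍ) : (Complex.I / 2) ^ (1 / 2 : ℂ) * (-4 * (τ : ℂ)) ^ (1 / 2 : ℂ) =
    (-Complex.I * (2 * (τ : ℂ))) ^ (1 / 2 : ℂ) := by
  have h1 : (Complex.I / 2 : ℂ) ≠ 0 := by simp
  have h2 : (-4 * (τ : ℂ)) ≠ 0 := by simpa using τ.ne_zero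
  have ha : Complex.arg (Complex.I / 2) = Real.pi / 2 := by
    have : (Complex.I / 2 : ℂ) = ((1 / 2 : ℝ) : ℂ) * Complex.I := by push_cast; ring
    rw [this, Complex.arg_real_mul _ (by norm_num), Complex.arg_I]
  have hb : Complex.arg (-4 * (τ : ℂ)) < 0 := by
    rw [Complex.arg_neg_iff]
    simp [τ.im_pos]
  have hc := Complex.neg_pi_lt_arg (-4 * (τ : ℂ))
  have e : -Complex.I * (2 * (τ : ℂ)) = (Complex.I / 2) * (-4 * (τ : ℂ)) := by ring
  rw [e, Complex.cpow_def_of_ne_zero h1, Complex.cpow_def_of_ne_zero h2,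
    Complex.cpow_def_of_ne_zero (mul_ne_zero h1 h2), Complex.log_mul h1 h2, ← Complex.exp_add,
    add_mul]
  rw [ha]
  constructor <;> linarith [Real.pi_pos]

theorem thetaAux_gamma (τ : ℍ) : thetaAux (lamGamma • τ) =
    auxChar lamGamma * (-4 * (τ : ℂ)) ^ (1 / 2 : ℂ) * thetaAux τ := by
  have hl : (Real.log 4 : ℂ) ≠ 0 := by
    exact_mod_cast (Real.log_pos (by norm_num)).ne'
  have : auxChar lamGamma = (Complex.I / 2) ^ (1 / 2 : ℂ) := by
    rw [auxChar, realDet_gamma, Complex.cpow_def_of_ne_zero (by simp), mul_div_cancel₀ _ hl]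
  rw [this, cpow_gamma]
  let t : ℍ := ⟨2 * τ, by simp [τ.im_pos]⟩
  have ht : (t : ℂ) = 2 * τ := rfl
  have hS := jacobiTheta_S_smul t
  rw [ht] at hS
  rw [thetaAux, thetaAux, ← hS, coe_lamGamma_smul, modular_S_smul]
  congr 1
  simp only [ht]
  have := τ.ne_zero
  field_simp
  norm_num

theorem half_unique {g : Lam} {φ ψ : ℍ → ℂ} (hφ : MDifferentiable 𝓘(ℂ) 𝓘(ℂ) φ)
    (hψ : MDifferentiable 𝓘(ℂ) 𝓘(ℂ) ψ)
    (h1 : ∀ τ, thetaAux (g • τ) = auxChar g * φ τ * thetaAux τ)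
    (h2 : ∀ τ, thetaAux (g • τ) = auxChar g * ψ τ * thetaAux τ) : φ = ψ := by
  have h : (φ - ψ) * thetaAux = 0 := by
    funext τ
    have := (h1 τ).symm.trans (h2 τ)
    rw [mul_assoc, mul_assoc] at this
    have := mul_left_cancel₀ (auxChar_ne_zero g) this
    simp [sub_mul, this]
  rw [UpperHalfPlane.mul_eq_zero_iff (hφ.sub hψ) thetaAux_mdiff] at h
  exact sub_eq_zero.1 (h.resolve_right thetaAux_ne_zero)

theorem half_gamma_mdiff :
    MDifferentiable 𝓘(ℂ) 𝓘(ℂ) (fun τ : ℍ => (-4 * (τ : ℂ)) ^ (1 / 2 : ℂ)) := by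
  rw [UpperHalfPlane.mdifferentiable_iff]
  intro z hz
  have hd : DifferentiableAt ℂ (fun z : ℂ => (-4 * z) ^ (1 / 2 : ℂ)) z := by
    refine DifferentiableAt.cpow_const (by fun_prop) ?_
    refine Or.inr ?_
    have : 0 < z.im := hz
    simpa using this.ne'
  refine (hd.differentiableWithinAt).congr (fun w hw => ?_) ?_
  · simp [ofComplex_apply_of_im_pos hw]
  · simp [ofComplex_apply_of_im_pos hz]

theorem half_exists (g : Lam) : ∃ φ : ℍ → ℂ, MDifferentiable 𝓘(ℂ) 𝓘(ℂ) φ ∧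
    (∀ τ, φ τ ^ 2 = denom (lamReal g) τ) ∧
    ∀ τ, thetaAux (g • τ) = auxChar g * φ τ * thetaAux τ := by
  have hden (x y : Lam) (τ : ℍ) : denom (lamReal (x * y)) τ =
      denom (lamReal x) (y • τ : ℍ) * denom (lamReal y) τ := by
    have hy : 0 < (lamReal y).det.val := by rw [lamReal_det]; exact realDet_pos y
    have : lamReal (x * y) = lamReal x * lamReal y := by simp [lamReal]
    rw [this, denom_cocycle_σ]
    rw [σ, if_pos hy]
    rfl
  refine lam_induction (P := fun g => ∃ φ : ℍ → ℂ, MDifferentiable 𝓘(ℂ) 𝓘(ℂ) φ ∧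
    (∀ τ, φ τ ^ 2 = denom (lamReal g) τ) ∧
    ∀ τ, thetaAux (g • τ) = auxChar g * φ τ * thetaAux τ) ?_ ?_ ?_ ?_ ?_ g
  · refine ⟨fun _ => 1, mdifferentiable_const, fun τ => ?_, thetaAux_alpha⟩
    simp [denom, lamReal, lamAlpha, matAlpha_val]
  · refine ⟨fun τ => (-4 * (τ : ℂ)) ^ (1 / 2 : ℂ), ?_, fun τ => ?_, thetaAux_gamma⟩
    · exact half_gamma_mdiff
    · have := Complex.cpow_nat_inv_pow (-4 * (τ : ℂ)) two_ne_zero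
      rw [Nat.cast_two, ← one_div] at this
      simp only [this]
      simp [denom, lamReal, lamGamma, matGamma_val, map_ofNat ZHalf.toReal]
  · refine ⟨fun _ => 1, mdifferentiable_const, fun τ => ?_, fun τ => ?_⟩
    · simp [denom, lamReal]
    · simp [auxChar, realDet_one]
  · rintro x y ⟨φ, h1, h2, h3⟩ ⟨ψ, k1, k2, k3⟩
    refine ⟨fun τ => φ (y • τ) * ψ τ, (h1.comp (lam_mdiff y)).mul k1, fun τ => ?_, fun τ => ?_⟩
    · rw [mul_pow, h2, k2, hden]
    · rw [mul_smul, h3, k3, auxChar_mul]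
      ring
  · rintro x ⟨φ, h1, h2, h3⟩
    have hφ (τ : ℍ) : φ τ ≠ 0 := by
      intro h
      have := h2 τ
      rw [h] at this
      exact denom_ne_zero (lamReal x) τ (by simpa using this.symm)
    have hx (τ : ℍ) := h3 (x⁻¹ • τ)
    have hinv : (fun τ : ℍ => (φ τ)⁻¹) = fun τ : ℍ => φ τ * (denom (lamReal x) τ)⁻¹ := by
      funext τ
      rw [← h2]
      have := hφ τ
      field_simp
    have hm : MDifferentiable 𝓘(ℂ) 𝓘(ℂ) (fun τ : ℍ => (φ τ)⁻¹) := by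
      rw [hinv]
      exact h1.mul (mdifferentiable_inv_denom _)
    refine ⟨fun τ => (φ (x⁻¹ • τ))⁻¹, hm.comp (lam_mdiff x⁻¹), fun τ => ?_, fun τ => ?_⟩
    · have := hden x x⁻¹ τ
      have h1' : denom (lamReal 1) τ = 1 := by simp [denom, lamReal]
      rw [mul_inv_cancel, h1'] at this
      rw [inv_pow, h2]
      exact inv_eq_of_mul_eq_one_right this.symm
    · have e : auxChar x * auxChar x⁻¹ = 1 := by
        rw [← auxChar_mul, mul_inv_cancel]
        simp [auxChar, realDet_one]
      have := hx τ
      rw [smul_inv_smul] at this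
      rw [this]
      have h := hφ (x⁻¹ • τ)
      field_simp
      linear_combination (-thetaAux (x⁻¹ • τ)) * e

/-- The factor of automorphy exists. -/
theorem exists_isHalfFactor : ∃ h : Lam → ℍ → ℂ, IsHalfFactor h ∧
    (∀ g, MDifferentiable 𝓘(ℂ) 𝓘(ℂ) (h g)) ∧ ∀ g τ, h g τ ^ 2 = denom (lamReal g) τ := by
  choose h h1 h2 h3 using half_exists
  refine ⟨h, ⟨fun x y τ => ?_, fun τ => ?_, fun τ => ?_⟩, h1, h2⟩
  · refine congrFun (half_unique (g := x * y) (ψ := fun τ => h x (y • τ) * h y τ) (h1 _)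
      (((h1 x).comp (lam_mdiff y)).mul (h1 y)) (h3 _) fun τ => ?_) τ
    rw [mul_smul, h3, h3, auxChar_mul]
    ring
  · exact congrFun (half_unique (g := lamAlpha) (ψ := fun _ => 1) (h1 _) mdifferentiable_const
      (h3 _) thetaAux_alpha) τ
  · exact congrFun (half_unique (g := lamGamma) (h1 _) half_gamma_mdiff (h3 _) thetaAux_gamma) τ

theorem IsHalfFactor.map_one {h : Lam → ℍ → ℂ} (H : IsHalfFactor h) (τ : ℍ) : h 1 τ = 1 := by
  have := H.cocycle 1 lamAlpha (lamAlpha⁻¹ • τ)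
  rwa [one_mul, H.alpha, smul_inv_smul, mul_one, eq_comm] at this

/-- The factor of automorphy is unique. -/
theorem IsHalfFactor.unique {h h' : Lam → ℍ → ℂ} (H : IsHalfFactor h) (H' : IsHalfFactor h') :
    h = h' := by
  funext g
  refine lam_induction (P := fun g => h g = h' g) ?_ ?_ ?_ ?_ ?_ g
  · funext τ
    rw [H.alpha, H'.alpha]
  · funext τ
    rw [H.gamma, H'.gamma]
  · funext τ
    rw [H.map_one, H'.map_one]
  · intro x y hx hy
    funext τ
    rw [H.cocycle, H'.cocycle, hx, hy]
  · intro x hx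
    funext τ
    have e (k : Lam → ℍ → ℂ) (K : IsHalfFactor k) : k x⁻¹ τ * k x (x⁻¹ • τ) = 1 := by
      rw [mul_comm, ← K.cocycle, mul_inv_cancel, K.map_one]
    exact (eq_inv_of_mul_eq_one_left (e h H)).trans
      (hx ▸ (eq_inv_of_mul_eq_one_left (e h' H')).symm)

/-- The unique cocycle `Λ × ℍ → ℂ` with value `1` at `α` and `√(-4τ)` at `γ`. -/
def halfFactor : Lam → ℍ → ℂ := exists_isHalfFactor.choose

theorem halfFactor_spec : IsHalfFactor halfFactor := exists_isHalfFactor.choose_spec.1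

theorem halfFactor_mdiff (g : Lam) : MDifferentiable 𝓘(ℂ) 𝓘(ℂ) (halfFactor g) :=
  exists_isHalfFactor.choose_spec.2.1 g

theorem halfFactor_sq (g : Lam) (τ : ℍ) : halfFactor g τ ^ 2 = denom (lamReal g) τ :=
  exists_isHalfFactor.choose_spec.2.2 g τ

/-! ### The slash action -/

/-- The space of holomorphic functions on the upper half plane. -/
def Hol : Submodule ℂ (ℍ → ℂ) where
  carrier := {ψ | MDifferentiable 𝓘(ℂ) 𝓘(ℂ) ψ}
  add_mem' := fun h h' => h.add h'
  zero_mem' := mdifferentiable_const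
  smul_mem' := fun c _ h => h.const_smul c

/-- The slash operator of weight `m / 2` and parameter `u`, for functions on `ℍ`. -/
def slash (m : ℤ) (u : ℂ) (g : Lam) (ψ : ℍ → ℂ) : ℍ → ℂ := fun τ =>
  halfFactor g⁻¹ τ ^ (-m) * (realDet g : ℂ) ^ (-u) * ψ (g⁻¹ • τ)

theorem halfFactor_ne_zero (g : Lam) (τ : ℍ) : halfFactor g τ ≠ 0 := by
  intro h
  have := halfFactor_sq g τ
  rw [h] at this
  exact denom_ne_zero (lamReal g) τ (by simpa using this.symm)

theorem slash_mem (m : ℤ) (u : ℂ) (g : Lam) {ψ : ℍ → ℂ} (hψ : ψ ∈ Hol) :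
    slash m u g ψ ∈ Hol := by
  have h1 : MDifferentiable 𝓘(ℂ) 𝓘(ℂ) (fun τ => halfFactor g⁻¹ τ ^ (-m)) := by
    rw [UpperHalfPlane.mdifferentiable_iff]
    exact ((UpperHalfPlane.mdifferentiable_iff.1 (halfFactor_mdiff g⁻¹)).zpow
      (Or.inl fun z _ => halfFactor_ne_zero _ _))
  exact (h1.mul mdifferentiable_const).mul (MDifferentiable.comp hψ (lam_mdiff g⁻¹))

/-- The slash action of `Λ` on the holomorphic functions, in weight `m / 2`. -/
def slashRep (m : ℤ) (u : ℂ) : Representation ℂ Lam Hol where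
  toFun g :=
    { toFun := fun ψ => ⟨slash m u g ψ, slash_mem m u g ψ.2⟩
      map_add' := fun ψ₁ ψ₂ => Subtype.ext (funext fun τ => by simp [slash, mul_add])
      map_smul' := fun c ψ => Subtype.ext (funext fun τ => by simp [slash]; ring) }
  map_one' := by
    refine LinearMap.ext fun ψ => Subtype.ext (funext fun τ => ?_)
    simp [slash, realDet_one, halfFactor_spec.map_one]
  map_mul' g₁ g₂ := by
    refine LinearMap.ext fun ψ => Subtype.ext (funext fun τ => ?_)
    have h1 : ((realDet (g₁ * g₂) : ℝ) : ℂ) ^ (-u) =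
        (realDet g₁ : ℂ) ^ (-u) * (realDet g₂ : ℂ) ^ (-u) := by
      rw [realDet_mul, Complex.ofReal_mul,
        Complex.mul_cpow_ofReal_nonneg (realDet_pos g₁).le (realDet_pos g₂).le]
    have h2 : halfFactor (g₁ * g₂)⁻¹ τ =
        halfFactor g₂⁻¹ (g₁⁻¹ • τ) * halfFactor g₁⁻¹ τ := by
      rw [mul_inv_rev, halfFactor_spec.cocycle]
    have h3 : (g₁ * g₂)⁻¹ • τ = g₂⁻¹ • g₁⁻¹ • τ := by rw [mul_inv_rev, mul_smul]
    simp only [slash, LinearMap.coe_mk, AddHom.coe_mk, Module.End.mul_apply, h1, h2, h3, mul_zpow]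
    ring

/-! ### Theta functions -/

/-- The space `V_p` of even functions on `(ℤ/pℤ)^d`. -/
def EvenFun (d p : ℕ) : Submodule ℂ ((Fin d → ZMod p) → ℂ) where
  carrier := {f | ∀ x, f (-x) = f x}
  add_mem' := fun ha hb x => by simp [ha x, hb x]
  zero_mem' := fun x => rfl
  smul_mem' := fun c f hf x => by simp [hf x]

/-- The finite Fourier transform `𝓕(f)(ξ) = ∑ₓ f(x) exp(-2πi (x · ξ) / p)`. -/
def fourierFin {d p : ℕ} [NeZero p] (f : (Fin d → ZMod p) → ℂ) : (Fin d → ZMod p) → ℂ :=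
  fun ξ => ∑ x : Fin d → ZMod p, f x * ZMod.stdAddChar (-(x ⬝ᵥ ξ))

/-- The general term, indexed by `x ∈ ℤ^d`, of the theta series `θ_f^j`:
`f(x) exp(2πi |x|² (τ - j) / p²)` with `0 ≤ j ≤ p - 1` for a finite `j`, and
`𝓕(f)(x) exp(2πi |x|² τ)` for `j = ∞`. -/
def thetaTerm {d p : ℕ} [NeZero p] (j : OnePoint (ZMod p)) (f : (Fin d → ZMod p) → ℂ) (τ : ℍ)
    (x : Fin d → ℤ) : ℂ :=
  match j with
  | ∞ => fourierFin f (fun i => (x i : ZMod p)) *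
      Complex.exp (2 * Real.pi * Complex.I * (x ⬝ᵥ x : ℤ) * τ)
  | OnePoint.some j => f (fun i => (x i : ZMod p)) *
      Complex.exp (2 * Real.pi * Complex.I * (x ⬝ᵥ x : ℤ) * ((τ - (j.val : ℂ)) / (p : ℂ) ^ 2))

/-- The theta function `θ_f^j`. -/
def theta {d p : ℕ} [NeZero p] (j : OnePoint (ZMod p)) (f : (Fin d → ZMod p) → ℂ) : ℍ → ℂ :=
  fun τ => ∑' x : Fin d → ℤ, thetaTerm j f τ x

/-- The multiplication operator `(L f)(x) = exp(-2πi |x|² / p) f(x)` in `GL(V_p)`. -/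
def opL (d p : ℕ) [NeZero p] : LinearMap.GeneralLinearGroup ℂ (EvenFun d p) where
  val :=
    { toFun := fun f => ⟨fun x => ZMod.stdAddChar (-(x ⬝ᵥ x)) * f.1 x, fun x => by simp [f.2 x]⟩
      map_add' := fun f g => Subtype.ext (funext fun x => by simp [mul_add])
      map_smul' := fun c f => Subtype.ext (funext fun x => by simp; ring) }
  inv :=
    { toFun := fun f => ⟨fun x => ZMod.stdAddChar (x ⬝ᵥ x) * f.1 x, fun x => by simp [f.2 x]⟩
      map_add' := fun f g => Subtype.ext (funext fun x => by simp [mul_add])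
      map_smul' := fun c f => Subtype.ext (funext fun x => by simp; ring) }
  val_inv := by
    refine LinearMap.ext fun f => Subtype.ext (funext fun x => ?_)
    simp [← mul_assoc, ← AddChar.map_add_eq_mul]
  inv_val := by
    refine LinearMap.ext fun f => Subtype.ext (funext fun x => ?_)
    simp [← mul_assoc, ← AddChar.map_add_eq_mul]

/-- The operator `(S_a f)(x) = f(a x)` in `GL(V_p)`, for a unit `a` modulo `p`. -/
def opS (d p : ℕ) (a : (ZMod p)ˣ) : LinearMap.GeneralLinearGroup ℂ (EvenFun d p) where
  val :=
    { toFun := fun f => ⟨fun x => f.1 (a • x), fun x => by simp only [smul_neg, f.2 _]⟩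
      map_add' := fun f g => rfl
      map_smul' := fun c f => rfl }
  inv :=
    { toFun := fun f => ⟨fun x => f.1 (a⁻¹ • x), fun x => by simp only [smul_neg, f.2 _]⟩
      map_add' := fun f g => rfl
      map_smul' := fun c f => rfl }
  val_inv := by
    refine LinearMap.ext fun f => Subtype.ext (funext fun x => ?_)
    simp
  inv_val := by
    refine LinearMap.ext fun f => Subtype.ext (funext fun x => ?_)
    simp

end

noncomputable section

/-! ### Arithmetic of `ℤ[1/2]` -/

/-! Write e(t) for exp(2πit). The theorem splits into an algebraic construction of `σ`, which makes
the cocycle property automatic, and an analytic check on the two generators.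

Algebra. `Λ` acts transitively on X, and s(∞) = 1, s(j) = α^j γ is a section of g ↦ g∞. Hence
s(gx)⁻¹ g s(x) is a cocycle with values in the stabilizer of ∞, which lies in `Δ` because its lower
left entries reduce to 0 mod p. Conjugation by (0 1; p 0) is an automorphism of `Δ` that exchanges
the roles of the upper right entry and of the lower left entry divided by p; applying it gives φ. An
element (a b; c e) of `Δ` of determinant 4^n is upper triangular mod p, so f(x) ↦ e(ab|x|²/(4^(n+1)
p)) f(ax/2^n) is a representation (`delScale_mul`, `delMult_mul`). Its composite with φ is σ. The
induced structure only uses transitivity (`isInducedFrom_cocycleRep`).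

Analysis. Both sides of the transformation formula are multiplicative in g, so α and γ suffice
(`slashRep_thetaLin`). Translation by α only re-indexes the series; the wrap from p - 1 to 0 costs
the phase L. The map γ is τ ↦ -1/(4τ), and Poisson summation with periodic coefficients
(`tsum_periodic_mul_cexp`) applies. Between ∞ and 0 it is used with period p. From j ≠ 0 to j' the
coefficients f(x) e(-j'|x|²/p²) have period p², and their finite Fourier transform is elementary
(`fourierFin_quadraticPhase`). Finally u is chosen so that 4^(-u) turns the automorphy factor
√(-4τ)^d into the Poisson factor √(-2iτ)^d (`slash_gamma_smul`). -/

theorem ZHalf.algebraMap_injective : Function.Injective (algebraMap ℤ ZHalf) :=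
  IsLocalization.injective _ (powers_le_nonZeroDivisors_of_noZeroDivisors two_ne_zero)

instance : IsDomain ZHalf :=
  IsLocalization.isDomain_localization (powers_le_nonZeroDivisors_of_noZeroDivisors two_ne_zero)

instance : CharZero ZHalf :=
  charZero_of_injective_algebraMap ZHalf.algebraMap_injective

/-- Clearing the power of 2 in the denominator reduces this to divisibility by p in ℤ. It identifies
the condition defining `Δ` with fixing ∞ mod p. -/
theorem ZHalf.exists_eq_mul_of_toZMod_eq_zero (p : ℕ) [Fact p.Prime] [Fact (p ≠ 2)] {z : ZHalf}
    (hz : ZHalf.toZMod p z = 0) : ∃ c, z = p * c := by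
  obtain ⟨n, a, h⟩ := IsLocalization.Away.surj (2 : ℤ) z
  have ha : (a : ZMod p) = 0 := by
    have := congrArg (ZHalf.toZMod p) h
    rw [map_mul, hz, zero_mul] at this
    simpa using this.symm
  obtain ⟨b, rfl⟩ := (ZMod.intCast_zmod_eq_zero_iff_dvd a p).1 ha
  refine ⟨b * ZHalf.half ^ n, ?_⟩
  have h2 : (2 : ZHalf) ^ n * ZHalf.half ^ n = 1 := by
    rw [← mul_pow, ZHalf.two_mul_half, one_pow]
  simp at h
  linear_combination ZHalf.half ^ n * h - z * h2

/-- Seen in ℝ. It makes the exponent n in det g = 4^n well defined, hence additive in g. -/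
theorem ZHalf.four_zpow_injective : Function.Injective fun n : ℤ => ZHalf.four ^ n := by
  intro m n h
  have h1 := congrArg (Units.map (ZHalf.toReal : ZHalf →* ℝ)) h
  have h2 := congrArg (fun x : ℝˣ => (x : ℝ)) h1
  simp only [map_zpow, Units.val_zpow_eq_zpow_val, Units.coe_map] at h2
  have h4 : ZHalf.toReal ZHalf.four = 4 := map_ofNat ZHalf.toReal 4
  exact zpow_right_injective₀ (by norm_num) (by norm_num) (a := (4 : ℝ)) (by simpa [h4] using h2)

/-! ### The representation of `Δ` -/

section DelRep

variable {p : ℕ}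

/-- The exponent `n` in `det g = 4 ^ n`. -/
def detExp (g : Del p) : ℤ := g.2.2.choose

theorem det_eq_detExp (g : Del p) :
    Matrix.GeneralLinearGroup.det g.1 = ZHalf.four ^ detExp g :=
  g.2.2.choose_spec

theorem detExp_eq_of_det {g : Del p} {n : ℤ}
    (h : Matrix.GeneralLinearGroup.det g.1 = ZHalf.four ^ n) : detExp g = n :=
  ZHalf.four_zpow_injective ((det_eq_detExp g).symm.trans h)

theorem detExp_one : detExp (1 : Del p) = 0 := detExp_eq_of_det (by simp)

theorem detExp_mul (g h : Del p) : detExp (g * h) = detExp g + detExp h :=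
  detExp_eq_of_det (by simp [det_eq_detExp, zpow_add])

variable (p) [Fact p.Prime] [Fact (p ≠ 2)]

theorem two_ne_zero_zmod : (2 : ZMod p) ≠ 0 := by
  simpa using (isUnit_two_zmod p).ne_zero

theorem four_ne_zero_zmod : (4 : ZMod p) ≠ 0 := by
  have : (4 : ZMod p) = 2 * 2 := by norm_num
  rw [this]
  exact mul_ne_zero (two_ne_zero_zmod p) (two_ne_zero_zmod p)

variable {p}

/-- The reduction of an entry of an element of `Δ` modulo `p`. -/
def redEntry (g : Del p) (i j : Fin 2) : ZMod p := ZHalf.toZMod p (g.1 i j)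

theorem redEntry_lower (g : Del p) : redEntry g 1 0 = 0 := by
  obtain ⟨c, hc⟩ := g.2.1
  simp [redEntry, hc]

theorem redEntry_mul (g h : Del p) (i j : Fin 2) :
    redEntry (g * h) i j = redEntry g i 0 * redEntry h 0 j + redEntry g i 1 * redEntry h 1 j := by
  simp [redEntry, Matrix.mul_apply, Fin.sum_univ_two]

/-- Mod p the matrix is upper triangular, so its determinant is the product of the diagonal entries.
-/
theorem redEntry_diag (g : Del p) : redEntry g 0 0 * redEntry g 1 1 = 4 ^ detExp g := by
  have h := congrArg (fun x => ((Units.map (ZHalf.toZMod p : ZHalf →* ZMod p) x : (ZMod p)ˣ) : ZMod p))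
    (det_eq_detExp g)
  have h4 : ZHalf.toZMod p ZHalf.four = 4 := map_ofNat (ZHalf.toZMod p) 4
  have hl := redEntry_lower g
  simp only [redEntry] at hl ⊢
  simpa [Matrix.det_fin_two, hl, h4] using h

/-- The scaling factor `a / 2 ^ n` of `(a b; c e)` of determinant `4 ^ n`. -/
def delScale (g : Del p) : ZMod p := redEntry g 0 0 * (2 ^ detExp g)⁻¹

/-- The multiplier `a b / 4 ^ (n + 1)` of `(a b; c e)` of determinant `4 ^ n`. -/
def delMult (g : Del p) : ZMod p := redEntry g 0 0 * redEntry g 0 1 * (4 * 4 ^ detExp g)⁻¹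

theorem delScale_one : delScale (1 : Del p) = 1 := by simp [delScale, redEntry, detExp_one]

theorem delMult_one : delMult (1 : Del p) = 0 := by simp [delMult, redEntry]

theorem delScale_mul (g h : Del p) : delScale (g * h) = delScale g * delScale h := by
  have h2 := two_ne_zero_zmod p
  simp only [delScale, redEntry_mul, detExp_mul, redEntry_lower, zpow_add₀ h2, mul_inv]
  ring

/-- The product has upper row entries a_g a_h and a_g b_h + b_g e_h. The relation a_h e_h = 4^n for
h removes h from the term containing b_g. The factor `delScale g ^ 2` is what |x|² acquires when x
is rescaled by g, so the phases compose as operators. -/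
theorem delMult_mul (g h : Del p) :
    delMult (g * h) = delMult g + delScale g ^ 2 * delMult h := by
  have h2 := two_ne_zero_zmod p
  have h4 := four_ne_zero_zmod p
  have hd := redEntry_diag h
  have e (n : ℤ) : (2 ^ n : ZMod p) ^ 2 = 4 ^ n := by
    rw [← zpow_natCast, zpow_comm, zpow_natCast]
    norm_num
  simp only [delScale, delMult, redEntry_mul, detExp_mul, redEntry_lower, zpow_add₀ h4, mul_pow,
    inv_pow, e]
  have hg0 : (4 : ZMod p) ^ detExp g ≠ 0 := zpow_ne_zero _ h4
  have hh0 : (4 : ZMod p) ^ detExp h ≠ 0 := zpow_ne_zero _ h4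
  field_simp
  linear_combination redEntry g 0 0 * redEntry g 0 1 * hd

/-- The representation of `Δ` on `V_p`, with values in the endomorphisms. -/
def delEnd (d p : ℕ) [Fact p.Prime] [Fact (p ≠ 2)] : Del p →* Module.End ℂ (EvenFun d p) where
  toFun g :=
    { toFun := fun f =>
        ⟨fun x => ZMod.stdAddChar (delMult g * (x ⬝ᵥ x)) * f.1 (delScale g • x),
          fun x => by simp [f.2 _]⟩
      map_add' := fun f f' => Subtype.ext (funext fun x => by simp [mul_add])
      map_smul' := fun c f => Subtype.ext (funext fun x => by simp; ring) }
  map_one' := by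
    refine LinearMap.ext fun f => Subtype.ext (funext fun x => ?_)
    simp [delMult_one, delScale_one]
  map_mul' g h := by
    refine LinearMap.ext fun f => Subtype.ext (funext fun x => ?_)
    simp only [LinearMap.coe_mk, AddHom.coe_mk, Module.End.mul_apply, delMult_mul, delScale_mul,
      add_mul, AddChar.map_add_eq_mul, dotProduct_smul, smul_dotProduct, smul_smul, smul_eq_mul,
      mul_assoc]
    rw [mul_comm (delScale g) (delScale h)]
    congr 3
    ring_nf

/-- The representation of `Δ` on `V_p`. -/
def delRep (d p : ℕ) [Fact p.Prime] [Fact (p ≠ 2)] :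
    Del p →* LinearMap.GeneralLinearGroup ℂ (EvenFun d p) :=
  (delEnd d p).toHomUnits

theorem delRep_apply {d : ℕ} (g : Del p) (f : EvenFun d p) (x : Fin d → ZMod p) :
    ((delRep d p g : EvenFun d p →ₗ[ℂ] EvenFun d p) f).1 x =
      ZMod.stdAddChar (delMult g * (x ⬝ᵥ x)) * f.1 (delScale g • x) := rfl

end DelRep

/-! ### Induced representations -/

open scoped Classical in
theorem isInternal_supportedAt {X V : Type*} [Fintype X] [AddCommGroup V] [Module ℂ V] :
    DirectSum.IsInternal fun x : X => (supportedAt x : Submodule ℂ (X → V)) := by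
  have e (x : X) : (supportedAt x : Submodule ℂ (X → V)) =
      LinearMap.range (LinearMap.single ℂ (fun _ : X => V) x) := by
    ext F
    constructor
    · intro hF
      refine ⟨F x, ?_⟩
      ext y
      by_cases h : y = x
      · subst h; simp
      · simp [h, hF y h]
    · rintro ⟨v, rfl⟩ y hy
      simp [hy]
  refine DirectSum.isInternal_submodule_of_iSupIndep_of_iSup_eq_top ?_ ?_
  · refine iSupIndep_def.2 fun x => ?_
    rw [Submodule.disjoint_def]
    intro F hF hF'
    have hle : (⨆ y, ⨆ (_ : y ≠ x), (supportedAt y : Submodule ℂ (X → V))) ≤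
        LinearMap.ker (LinearMap.proj x : (X → V) →ₗ[ℂ] V) := by
      refine iSup₂_le fun y hy G hG => ?_
      exact hG x hy.symm
    ext y
    by_cases h : y = x
    · subst h
      exact hle hF'
    · exact hF y h
  · simp_rw [e]
    exact LinearMap.iSup_range_single ℂ _

/-- The operator of g permutes the fibres over X as g permutes the points; invertibility of g
upgrades the inclusion to an equality. -/
theorem map_cocycleRep_supportedAt {G X V : Type*} [Group G] [MulAction G X] [AddCommGroup V]
    [Module ℂ V] {σ : G → X → LinearMap.GeneralLinearGroup ℂ V} (hσ : IsCocycle σ) (g : G)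
    (x : X) :
    (supportedAt x).map (cocycleRep σ hσ g) = supportedAt (g • x) := by
  have key (g : G) (x : X) {F : X → V} (hF : F ∈ supportedAt x) :
      cocycleRep σ hσ g F ∈ supportedAt (g • x) := by
    intro y hy
    have : F (g⁻¹ • y) = 0 := hF _ fun h => hy (by rw [← h, smul_inv_smul])
    simp [cocycleRep, this]
  refine le_antisymm (Submodule.map_le_iff_le_comap.2 fun F hF => key g x hF) fun F hF => ?_
  refine ⟨cocycleRep σ hσ g⁻¹ F, ?_, ?_⟩
  · simpa using key g⁻¹ (g • x) hF
  · rw [← Module.End.mul_apply, ← map_mul]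
    simp

theorem isInducedFrom_cocycleRep {G X V : Type*} [Group G] [MulAction G X] [Fintype X]
    [MulAction.IsPretransitive G X] [AddCommGroup V]
    [Module ℂ V] {σ : G → X → LinearMap.GeneralLinearGroup ℂ V} (hσ : IsCocycle σ) (x : X) :
    IsInducedFrom (cocycleRep σ hσ) (MulAction.stabilizer G x) (supportedAt x) := by
  classical
  refine ⟨fun h hh w hw => ?_, ?_⟩
  · have := map_cocycleRep_supportedAt hσ h x
    rw [MulAction.mem_stabilizer_iff.1 hh] at this
    exact this ▸ Submodule.mem_map_of_mem hw
  -- The orbit-stabilizer bijection re-indexes the translates over cosets as the fibres over points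
  -- of X.
  · let e : G ⧸ MulAction.stabilizer G x ≃ X :=
      Equiv.ofBijective (MulAction.ofQuotientStabilizer G x)
        ⟨MulAction.injective_ofQuotientStabilizer G x, fun y =>
          (MulAction.exists_smul_eq G x y).imp' QuotientGroup.mk fun _ h => h⟩
    have he (c : G ⧸ MulAction.stabilizer G x) : e c = c.out • x := by
      conv_lhs => rw [← Quotient.out_eq' c]
      rfl
    simp only [map_cocycleRep_supportedAt, ← he]
    have hX := isInternal_supportedAt (X := X) (V := V)
    rw [DirectSum.isInternal_submodule_iff_iSupIndep_and_iSup_eq_top] at hX ⊢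
    refine ⟨hX.1.comp e.injective, ?_⟩
    rw [← hX.2]
    exact e.iSup_comp (g := fun y => (supportedAt y : Submodule ℂ (X → V)))

/-! ### The cocycle with values in `Δ` -/

section DelCocycle

variable {p : ℕ}

/-- The quotient `c` in the lower left entry `p c` of an element of `Δ`. -/
def lowerQuot (g : Del p) : ZHalf := g.2.1.choose

theorem lowerQuot_spec (g : Del p) : g.1 1 0 = p * lowerQuot g := g.2.1.choose_spec

/-- Conjugation by `(0 1; p 0)` on matrices, `(a b; pc e) ↦ (e c; pb a)`. -/
def flipMat (g : Del p) : Matrix (Fin 2) (Fin 2) ZHalf :=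
  !![g.1 1 1, lowerQuot g; p * g.1 0 1, g.1 0 0]

theorem det_flipMat (g : Del p) : (flipMat g).det = Matrix.GeneralLinearGroup.det g.1 := by
  rw [flipMat, Matrix.det_fin_two_of, Matrix.GeneralLinearGroup.val_det_apply, Matrix.det_fin_two,
    lowerQuot_spec]
  ring

theorem isUnit_det_flipMat (g : Del p) : IsUnit (flipMat g).det :=
  det_flipMat g ▸ Units.isUnit _

/-- The automorphism `(a b; pc e) ↦ (e c; pb a)` of `Δ`. -/
def delFlip (p : ℕ) [NeZero p] : Del p →* Del p where
  toFun g := ⟨.mk'' (flipMat g) (isUnit_det_flipMat g), ⟨g.1 0 1, rfl⟩, by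
    obtain ⟨n, hn⟩ := g.2.2
    refine ⟨n, Units.ext ?_⟩
    rw [← hn, ← det_flipMat]
    rfl⟩
  map_one' := by
    have h : lowerQuot (1 : Del p) = 0 := by
      have := lowerQuot_spec (1 : Del p)
      simpa [NeZero.ne p] using this
    refine Subtype.ext (Units.ext ?_)
    change flipMat 1 = 1
    simp [flipMat, h, Matrix.one_fin_two]
  map_mul' g h := by
    have hp : (p : ZHalf) ≠ 0 := Nat.cast_ne_zero.2 (NeZero.ne p)
    -- `lowerQuot` is a choice, but p is nonzero in a domain, so cancelling p determines it.
    have e : lowerQuot (g * h) = lowerQuot g * h.1 0 0 + g.1 1 1 * lowerQuot h := by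
      refine mul_left_cancel₀ hp ?_
      rw [← lowerQuot_spec, mul_add, mul_left_comm (p : ZHalf) (g.1 1 1), ← lowerQuot_spec h,
        ← mul_assoc, ← lowerQuot_spec g]
      simp [Matrix.mul_apply, Fin.sum_univ_two]
    refine Subtype.ext (Units.ext ?_)
    change flipMat (g * h) = flipMat g * flipMat h
    rw [flipMat, e, flipMat, flipMat, Matrix.mul_fin_two]
    have hg := lowerQuot_spec g
    have hh := lowerQuot_spec h
    simp only [Subgroup.coe_mul, Matrix.GeneralLinearGroup.coe_mul, Matrix.mul_apply,
      Fin.sum_univ_two, hg, hh]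
    congr 1
    ext i j
    fin_cases i <;> fin_cases j <;> simp <;> ring

theorem delFlip_val [NeZero p] (g : Del p) {a b c e : ZHalf}
    (h : g.1.val = !![a, b; p * c, e]) : (delFlip p g).1.val = !![e, c; p * b, a] := by
  have hp : (p : ZHalf) ≠ 0 := Nat.cast_ne_zero.2 (NeZero.ne p)
  have hc : lowerQuot g = c := by
    refine mul_left_cancel₀ hp ?_
    rw [← lowerQuot_spec]
    simp [h]
  change flipMat g = _
  simp [flipMat, hc, h]

variable (p) [Fact p.Prime]

theorem val_succ_of_le {j : ℕ} (hj : j ≤ p - 2) :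
    (j : ZMod p).val = j ∧ ((j : ZMod p) + 1).val = j + 1 := by
  have h2 := (Fact.out : p.Prime).two_le
  refine ⟨ZMod.val_cast_of_lt (by omega), ?_⟩
  have : ((j : ZMod p) + 1) = ((j + 1 : ℕ) : ZMod p) := by push_cast; rfl
  rw [this]
  exact ZMod.val_cast_of_lt (by omega)

theorem natCast_sub_one_add_one : ((p - 1 : ℕ) : ZMod p) + 1 = 0 := by
  have h2 := (Fact.out : p.Prime).two_le
  rw [Nat.cast_sub (by omega)]
  simp

variable [Fact (p ≠ 2)]

/-! ### The stabilizer of ∞ inside `Δ` -/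

theorem toZMod_lower_eq_zero_of_fix {g : GL (Fin 2) ZHalf}
    (h : g • (∞ : OnePoint (ZMod p)) = ∞) : ZHalf.toZMod p (g 1 0) = 0 := by
  have h' : Matrix.GeneralLinearGroup.map (n := Fin 2) (ZHalf.toZMod p) g •
      (∞ : OnePoint (ZMod p)) = ∞ := h
  rwa [OnePoint.smul_infty_eq_self_iff] at h'

theorem lam_det (g : Lam) :
    ∃ n : ℤ, Matrix.GeneralLinearGroup.det (g : GL (Fin 2) ZHalf) = ZHalf.four ^ n := by
  refine lam_induction (P := fun g =>
    ∃ n : ℤ, Matrix.GeneralLinearGroup.det (g : GL (Fin 2) ZHalf) = ZHalf.four ^ n) ?_ ?_ ?_ ?_ ?_ g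
  · exact ⟨0, Units.ext (by simp [lamAlpha, matAlpha_val, Matrix.det_fin_two])⟩
  · exact ⟨1, Units.ext (by simp [lamGamma, matGamma_val, Matrix.det_fin_two, ZHalf.four])⟩
  · exact ⟨0, by simp⟩
  · rintro x y ⟨m, hm⟩ ⟨n, hn⟩
    exact ⟨m + n, by simp [hm, hn, zpow_add]⟩
  · rintro x ⟨m, hm⟩
    exact ⟨-m, by simp [hm]⟩

/-- The inclusion of the stabilizer of `∞` in `Δ`. -/
def stabToDel : MulAction.stabilizer Lam (∞ : OnePoint (ZMod p)) →* Del p where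
  toFun g := ⟨g.1.1, ZHalf.exists_eq_mul_of_toZMod_eq_zero p (toZMod_lower_eq_zero_of_fix p g.2),
    lam_det g.1⟩
  map_one' := rfl
  map_mul' _ _ := rfl

/-! ### The action of the generators on the projective line and a section of the orbit map -/

theorem lam_smul_def_zmod (g : Lam) (x : OnePoint (ZMod p)) :
    g • x = Matrix.GeneralLinearGroup.map (n := Fin 2) (ZHalf.toZMod p) g.1 • x := rfl

theorem lamAlpha_smul_infty : lamAlpha • (∞ : OnePoint (ZMod p)) = ∞ := by
  rw [lam_smul_def_zmod, OnePoint.smul_infty_eq_self_iff]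
  simp [lamAlpha, matAlpha_val]

theorem lamAlpha_smul_some (j : ZMod p) :
    lamAlpha • (j : OnePoint (ZMod p)) = ((j + 1 : ZMod p) : OnePoint (ZMod p)) := by
  rw [lam_smul_def_zmod, OnePoint.smul_some_eq_ite]
  simp [lamAlpha, matAlpha_val]

theorem lamGamma_smul_infty :
    lamGamma • (∞ : OnePoint (ZMod p)) = ((0 : ZMod p) : OnePoint (ZMod p)) := by
  rw [lam_smul_def_zmod, OnePoint.smul_infty_eq_ite]
  simp [lamGamma, matGamma_val, map_ofNat (ZHalf.toZMod p), four_ne_zero_zmod]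

theorem lamGamma_smul_zero :
    lamGamma • ((0 : ZMod p) : OnePoint (ZMod p)) = ∞ := by
  rw [lam_smul_def_zmod, OnePoint.smul_some_eq_ite]
  simp [lamGamma, matGamma_val]

theorem lamGamma_smul_some {j j' : ZMod p} (h : 4 * j * j' + 1 = 0) :
    lamGamma • (j : OnePoint (ZMod p)) = (j' : OnePoint (ZMod p)) := by
  have hj : j ≠ 0 := by
    rintro rfl
    simp at h
  have h4 := four_ne_zero_zmod p
  rw [lam_smul_def_zmod, OnePoint.smul_some_eq_ite]
  simp only [lamGamma, matGamma_val, Matrix.GeneralLinearGroup.map_apply]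
  simp [map_ofNat (ZHalf.toZMod p), h4, hj]
  field_simp
  linear_combination -h

/-- The element `α ^ j γ` of `Λ`, with `0 ≤ j ≤ p - 1`, which carries `∞` to `j`. -/
def toPoint : OnePoint (ZMod p) → Lam
  | ∞ => 1
  | OnePoint.some j => lamAlpha ^ j.val * lamGamma

theorem lamAlpha_pow_smul_some (n : ℕ) (j : ZMod p) :
    lamAlpha ^ n • (j : OnePoint (ZMod p)) = ((j + n : ZMod p) : OnePoint (ZMod p)) := by
  induction n with
  | zero => simp
  | succ n ih =>
    rw [pow_succ', mul_smul, ih, lamAlpha_smul_some]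
    push_cast
    rw [add_assoc]

theorem toPoint_smul (x : OnePoint (ZMod p)) : toPoint p x • (∞ : OnePoint (ZMod p)) = x := by
  cases x with
  | infty => exact one_smul _ _
  | coe j =>
    change (lamAlpha ^ j.val * lamGamma) • (∞ : OnePoint (ZMod p)) = _
    rw [mul_smul, lamGamma_smul_infty, lamAlpha_pow_smul_some]
    simp

instance : MulAction.IsPretransitive Lam (OnePoint (ZMod p)) :=
  ⟨fun x y => ⟨toPoint p y * (toPoint p x)⁻¹, by
    rw [mul_smul, inv_smul_eq_iff.2 (toPoint_smul p x).symm, toPoint_smul]⟩⟩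

/-- The cocycle `s(g x)⁻¹ g s(x)` with values in the stabilizer of `∞`, where `s(x) ∞ = x`. -/
def stabCocycle (g : Lam) (x : OnePoint (ZMod p)) :
    MulAction.stabilizer Lam (∞ : OnePoint (ZMod p)) :=
  ⟨(toPoint p (g • x))⁻¹ * g * toPoint p x, by
    rw [MulAction.mem_stabilizer_iff, mul_smul, mul_smul, toPoint_smul, inv_smul_eq_iff,
      toPoint_smul]⟩

theorem isCocycle_stabCocycle : IsCocycle (stabCocycle p) := by
  intro g h x
  refine Subtype.ext ?_
  simp [stabCocycle, mul_smul, mul_assoc]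

/-- The cocycle `Λ × X → Δ`. -/
def delCocycle (g : Lam) (x : OnePoint (ZMod p)) : Del p :=
  delFlip p (stabToDel p (stabCocycle p g x))

theorem isCocycle_delCocycle : IsCocycle (delCocycle p) := by
  intro g h x
  simp only [delCocycle, isCocycle_stabCocycle p g h x, map_mul]

/-! ### Values of the `Δ`-valued cocycle on the generators -/

theorem delCocycle_eq_one {g : Lam} {x : OnePoint (ZMod p)}
    (h : g * toPoint p x = toPoint p (g • x)) : delCocycle p g x = 1 := by
  have : stabCocycle p g x = 1 := by
    refine Subtype.ext ?_
    simp [stabCocycle, mul_assoc, h]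
  simp [delCocycle, this]

/-- Solving g s(x) = s(gx) h for h gives the stabilizer cocycle without computing an inverse; the
flip then rearranges the entries of h. -/
theorem delCocycle_val {g h : Lam} {x : OnePoint (ZMod p)} {a b c e : ZHalf}
    (hg : g * toPoint p x = toPoint p (g • x) * h) (hh : h.1.val = !![a, b; p * c, e]) :
    (delCocycle p g x).1.val = !![e, c; p * b, a] := by
  refine delFlip_val _ ?_
  rw [← hh]
  have : (stabCocycle p g x).1 = h := by
    simp [stabCocycle, mul_assoc, hg]
  rw [← this]
  rfl

theorem lamAlpha_pow_val (n : ℕ) : (lamAlpha ^ n).1.val = !![1, (n : ZHalf); 0, 1] := by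
  induction n with
  | zero => simp [Matrix.one_fin_two]
  | succ n ih =>
    rw [pow_succ, Subgroup.coe_mul, Matrix.GeneralLinearGroup.coe_mul, ih]
    simp [lamAlpha, matAlpha_val, add_comm]

theorem delCocycle_alpha {j : ℕ} (hj : j ≤ p - 2) :
    delCocycle p lamAlpha ((j : ZMod p) : OnePoint (ZMod p)) = 1 := by
  refine delCocycle_eq_one p ?_
  rw [lamAlpha_smul_some]
  change lamAlpha * (lamAlpha ^ (j : ZMod p).val * lamGamma) =
    lamAlpha ^ ((j : ZMod p) + 1).val * lamGamma
  rw [(val_succ_of_le p hj).1, (val_succ_of_le p hj).2, pow_succ', mul_assoc]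

/-- The exponent of α reaches p while the section restarts at 0, leaving γ⁻¹ α^p γ = (1 0; -4p 1).
The flip moves -4 to the upper right corner, where the representation of `Δ` sees it and produces L.
-/
theorem delCocycle_alpha_last :
    (delCocycle p lamAlpha (((p - 1 : ℕ) : ZMod p) : OnePoint (ZMod p))).1.val =
      !![1, -4; 0, 1] := by
  have h2 := (Fact.out : p.Prime).two_le
  have h := delCocycle_val p (g := lamAlpha) (h := lamGamma⁻¹ * lamAlpha ^ p * lamGamma)
    (x := ((p - 1 : ℕ) : ZMod p)) (a := 1) (b := 0) (c := -4) (e := 1) ?_ ?_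
  · simpa using h
  · rw [lamAlpha_smul_some, natCast_sub_one_add_one]
    change lamAlpha * (lamAlpha ^ ((p - 1 : ℕ) : ZMod p).val * lamGamma) =
      lamAlpha ^ (0 : ZMod p).val * lamGamma * _
    rw [ZMod.val_cast_of_lt (by omega), ← mul_assoc, ← pow_succ', Nat.sub_add_cancel (by omega)]
    simp [mul_assoc]
  -- The matrix is identified after multiplication by γ on the left, so that γ⁻¹ need not be written
  -- out.
  · have e : lamGamma.1.val * (lamGamma⁻¹ * lamAlpha ^ p * lamGamma).1.val =
        lamGamma.1.val * !![1, 0; (p : ZHalf) * -4, 1] := by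
      rw [← Matrix.GeneralLinearGroup.coe_mul, ← Subgroup.coe_mul, ← mul_assoc, ← mul_assoc,
        mul_inv_cancel, one_mul, Subgroup.coe_mul, Matrix.GeneralLinearGroup.coe_mul,
        lamAlpha_pow_val]
      simp [lamGamma, matGamma_val]
    exact lamGamma.1.isUnit.mul_left_cancel e

theorem delCocycle_alpha_infty :
    (delCocycle p lamAlpha ∞).1.val = !![1, 0; (p : ZHalf), 1] := by
  have h := delCocycle_val p (g := lamAlpha) (h := lamAlpha)
    (x := ∞) (a := 1) (b := 1) (c := 0) (e := 1) ?_ ?_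
  · simpa using h
  · rw [lamAlpha_smul_infty]
    change lamAlpha * 1 = 1 * lamAlpha
    rw [mul_one, one_mul]
  · simp [lamAlpha, matAlpha_val]

theorem delCocycle_gamma_infty : delCocycle p lamGamma ∞ = 1 := by
  refine delCocycle_eq_one p ?_
  rw [lamGamma_smul_infty]
  change lamGamma * 1 = lamAlpha ^ (0 : ZMod p).val * lamGamma
  simp

theorem delCocycle_gamma_zero :
    (delCocycle p lamGamma ((0 : ZMod p) : OnePoint (ZMod p))).1.val = !![-4, 0; 0, -4] := by
  have h := delCocycle_val p (g := lamGamma) (h := lamGamma * lamGamma)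
    (x := ((0 : ZMod p) : OnePoint (ZMod p))) (a := -4) (b := 0) (c := 0) (e := -4) ?_ ?_
  · simpa using h
  · rw [lamGamma_smul_zero]
    change lamGamma * (lamAlpha ^ (0 : ZMod p).val * lamGamma) = 1 * (lamGamma * lamGamma)
    simp
  · simp [lamGamma, matGamma_val]

theorem delCocycle_gamma_some {j j' : ℕ} {k : ℤ} (hj : j ≤ p - 1) (hj' : j' ≤ p - 1)
    (h : 4 * (j : ℤ) * j' + 1 = p * k) :
    (delCocycle p lamGamma ((j : ZMod p) : OnePoint (ZMod p))).1.val =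
      !![4 * (j' : ZHalf), -4 * (k : ZHalf); (p : ZHalf), -4 * (j : ZHalf)] := by
  have h2 := (Fact.out : p.Prime).two_le
  have hz := congrArg (fun n : ℤ => (n : ZHalf)) h
  have hp := congrArg (fun n : ℤ => (n : ZMod p)) h
  push_cast at hz hp
  rw [ZMod.natCast_self, zero_mul] at hp
  have key := delCocycle_val p (g := lamGamma)
    (h := lamGamma⁻¹ * (lamAlpha ^ j')⁻¹ * (lamGamma * lamAlpha ^ j * lamGamma))
    (x := ((j : ZMod p) : OnePoint (ZMod p))) (a := -4 * j) (b := 1) (c := -4 * k) (e := 4 * j')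
    ?_ ?_
  · simpa using key
  · rw [lamGamma_smul_some p hp]
    change lamGamma * (lamAlpha ^ (j : ZMod p).val * lamGamma) =
      lamAlpha ^ (j' : ZMod p).val * lamGamma * _
    rw [ZMod.val_cast_of_lt (by omega), ZMod.val_cast_of_lt (by omega)]
    group
  -- Again compared after left multiplication. Both sides equal γ α^j γ = (-4 0; 16j -4), and only
  -- the upper left entry uses 4jj' + 1 = pk.
  · have e : (lamAlpha ^ j' * lamGamma).1.val *
        (lamGamma⁻¹ * (lamAlpha ^ j')⁻¹ * (lamGamma * lamAlpha ^ j * lamGamma)).1.val =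
        (lamAlpha ^ j' * lamGamma).1.val * !![-4 * (j : ZHalf), 1; p * (-4 * k), 4 * j'] := by
      rw [← Matrix.GeneralLinearGroup.coe_mul, ← Subgroup.coe_mul, ← mul_inv_rev,
        mul_inv_cancel_left]
      simp only [Subgroup.coe_mul, Matrix.GeneralLinearGroup.coe_mul, lamAlpha_pow_val]
      simp only [lamGamma, matGamma_val, Matrix.mul_fin_two]
      ext i l
      fin_cases i <;> fin_cases l <;> simp <;>
        first | ring1 | linear_combination (-4 : ZHalf) * hz
    exact (lamAlpha ^ j' * lamGamma).1.isUnit.mul_left_cancel e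

end DelCocycle

/-! ### Gaussian sums over `ℤ ^ d` -/

/-- Induction on d, splitting off the first coordinate. It reduces Gaussian sums over ℤ^d to sums
over ℤ. -/
theorem summable_norm_prod_and_tsum_prod {ι : Type*} {d : ℕ} (f : Fin d → ι → ℂ)
    (hf : ∀ i, Summable fun n => ‖f i n‖) :
    (Summable fun x : Fin d → ι => ‖∏ i, f i (x i)‖) ∧
      ∑' x : Fin d → ι, ∏ i, f i (x i) = ∏ i, ∑' n, f i n := by
  induction d with
  | zero => exact ⟨Summable.of_finite, by simp⟩
  | succ d ih =>
    obtain ⟨h1, h2⟩ := ih (fun i => f i.succ) fun i => hf i.succ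
    have e (x : ι × (Fin d → ι)) : ∏ i, f i (Fin.consEquiv (fun _ => ι) x i) =
        f 0 x.1 * ∏ i : Fin d, f i.succ (x.2 i) := by
      rw [Fin.prod_univ_succ]
      simp [Fin.consEquiv]
    constructor
    · rw [← (Fin.consEquiv fun _ => ι).summable_iff]
      refine ((hf 0).mul_norm h1).congr fun x => ?_
      simp only [Function.comp_apply, e]
    · rw [← (Fin.consEquiv fun _ => ι).tsum_eq]
      simp only [e]
      rw [← tsum_mul_tsum_of_summable_norm (hf 0) h1, h2, Fin.prod_univ_succ]

theorem cexp_dotProduct_self {d : ℕ} (x : Fin d → ℤ) (w : ℂ) :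
    Complex.exp (2 * Real.pi * Complex.I * (x ⬝ᵥ x : ℤ) * w) =
      ∏ i, Complex.exp (2 * Real.pi * Complex.I * (x i : ℂ) ^ 2 * w) := by
  rw [← Complex.exp_sum, dotProduct]
  push_cast
  rw [Finset.mul_sum, Finset.sum_mul]
  simp only [sq]

/-- These are the terms of the Jacobi theta series at z = 0 and parameter 2w. -/
theorem summable_norm_cexp_sq {w : ℂ} (hw : 0 < w.im) :
    Summable fun n : ℤ => ‖Complex.exp (2 * Real.pi * Complex.I * (n : ℂ) ^ 2 * w)‖ := by
  have h := ((summable_jacobiTheta₂_term_iff 0 (2 * w)).2 (by simpa using hw)).norm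
  refine h.congr fun n => ?_
  rw [jacobiTheta₂_term]
  congr 2
  ring

theorem summable_norm_cexp_dotProduct {d : ℕ} {w : ℂ} (hw : 0 < w.im) :
    Summable fun x : Fin d → ℤ =>
      ‖Complex.exp (2 * Real.pi * Complex.I * (x ⬝ᵥ x : ℤ) * w)‖ := by
  simp only [cexp_dotProduct_self]
  exact (summable_norm_prod_and_tsum_prod
    (fun _ (n : ℤ) => Complex.exp (2 * Real.pi * Complex.I * (n : ℂ) ^ 2 * w))
    fun _ => summable_norm_cexp_sq hw).1

theorem dotProduct_self_int_nonneg {d : ℕ} (x : Fin d → ℤ) : 0 ≤ x ⬝ᵥ x :=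
  Finset.sum_nonneg fun i _ => mul_self_nonneg (x i)

theorem norm_cexp_dotProduct {d : ℕ} (x : Fin d → ℤ) (w : ℂ) :
    ‖Complex.exp (2 * Real.pi * Complex.I * (x ⬝ᵥ x : ℤ) * w)‖ =
      Real.exp (-(2 * Real.pi * (x ⬝ᵥ x : ℤ) * w.im)) := by
  rw [Complex.norm_exp]
  congr 1
  have : 2 * Real.pi * Complex.I * ((x ⬝ᵥ x : ℤ) : ℂ) * w =
      ((2 * Real.pi * ((x ⬝ᵥ x : ℤ) : ℝ) : ℝ) : ℂ) * (Complex.I * w) := by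
    push_cast
    ring
  rw [this, Complex.re_ofReal_mul]
  simp

theorem summable_mul_cexp_dotProduct {d : ℕ} {c : (Fin d → ℤ) → ℂ} {C : ℝ} (hc : ∀ x, ‖c x‖ ≤ C)
    {w : ℂ} (hw : 0 < w.im) :
    Summable fun x : Fin d → ℤ =>
      c x * Complex.exp (2 * Real.pi * Complex.I * (x ⬝ᵥ x : ℤ) * w) := by
  refine Summable.of_norm_bounded ((summable_norm_cexp_dotProduct hw).mul_left C) fun x => ?_
  rw [norm_mul]
  gcongr
  exact hc x

theorem differentiableOn_tsum_cexp_dotProduct {d : ℕ} {c : (Fin d → ℤ) → ℂ} {C : ℝ}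
    (hc : ∀ x, ‖c x‖ ≤ C) :
    DifferentiableOn ℂ (fun w : ℂ => ∑' x : Fin d → ℤ,
      c x * Complex.exp (2 * Real.pi * Complex.I * (x ⬝ᵥ x : ℤ) * w)) {w | 0 < w.im} := by
  intro z hz
  have hz' : 0 < z.im := hz
  have hC : 0 ≤ C := (norm_nonneg _).trans (hc 0)
  -- On the half-plane Im w > Im z / 2, a neighbourhood of z, each exponential is bounded by its
  -- absolute value at z₀, which gives the summable majorant of the Weierstrass test.
  let z₀ : ℂ := (z.im / 2 : ℝ) * Complex.I
  have hz₀ : z₀.im = z.im / 2 := by simp [z₀]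
  have ho : IsOpen {w : ℂ | z.im / 2 < w.im} := isOpen_lt continuous_const Complex.continuous_im
  have h := Complex.differentiableOn_tsum_of_summable_norm
    (F := fun (x : Fin d → ℤ) (w : ℂ) =>
      c x * Complex.exp (2 * Real.pi * Complex.I * (x ⬝ᵥ x : ℤ) * w))
    ((summable_norm_cexp_dotProduct (d := d) (w := z₀) (by linarith)).mul_left C)
    (fun x => by fun_prop) ho fun x w hw => ?_
  · exact (h.differentiableAt (ho.mem_nhds (by simp; linarith))).differentiableWithinAt
  · rw [norm_mul, norm_cexp_dotProduct, norm_cexp_dotProduct, hz₀]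
    have hx : (0 : ℝ) ≤ ((x ⬝ᵥ x : ℤ) : ℝ) := by exact_mod_cast dotProduct_self_int_nonneg x
    have hw' : z.im / 2 ≤ w.im := le_of_lt hw
    have := hc x
    gcongr

/-! ### Poisson summation for periodic coefficients -/

/-- One-dimensional Poisson summation on a single residue class: twisting the Gaussian by a
character mod N shifts the dual lattice by r/N, and after scaling by N the dual sum runs over n ≡ r.
-/
theorem tsum_indicator_cexp_sq {N : ℕ} [NeZero N] (r : ZMod N) {τ : ℂ} (hτ : 0 < τ.im) :
    ∑' n : ℤ, (if (n : ZMod N) = r then 1 else 0) *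
        Complex.exp (2 * Real.pi * Complex.I * (n : ℂ) ^ 2 * (-1 / (4 * (N : ℂ) ^ 2 * τ))) =
      (-Complex.I * (2 * τ)) ^ (1 / 2 : ℂ) * ∑' n : ℤ, ZMod.stdAddChar (-(r * (n : ZMod N))) *
        Complex.exp (2 * Real.pi * Complex.I * (n : ℂ) ^ 2 * τ) := by
  have hN : (N : ℂ) ≠ 0 := Nat.cast_ne_zero.2 (NeZero.ne N)
  have hτ0 : τ ≠ 0 := by
    rintro rfl
    simp at hτ
  obtain ⟨s, rfl⟩ := ZMod.intCast_surjective r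
  have ha : 0 < (-Complex.I * (2 * τ)).re := by simpa using hτ
  have ha0 : (-Complex.I * (2 * τ)) ^ (1 / 2 : ℂ) ≠ 0 := by
    rw [Complex.cpow_ne_zero_iff]
    left
    simp [hτ0]
  -- Here a = -2iτ and the linear term b = -is/N, so n + ib = (s + Nn)/N.
  have key := Complex.tsum_exp_neg_quadratic ha (-Complex.I * s / N)
  have e1 (n : ℤ) : Complex.exp (-Real.pi * (-Complex.I * (2 * τ)) * (n : ℂ) ^ 2 +
      2 * Real.pi * (-Complex.I * s / N) * n) =
      ZMod.stdAddChar (-((s : ZMod N) * (n : ZMod N))) *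
        Complex.exp (2 * Real.pi * Complex.I * (n : ℂ) ^ 2 * τ) := by
    have : -((s : ZMod N) * (n : ZMod N)) = ((-(s * n) : ℤ) : ZMod N) := by push_cast; ring
    rw [this, ZMod.stdAddChar_coe, ← Complex.exp_add]
    congr 1
    push_cast
    ring
  -- This map parametrizes the class of s mod N, the support of the indicator.
  have hinj : Function.Injective fun n : ℤ => s + N * n := fun m n h => by
    simpa [NeZero.ne N] using h
  rw [tsum_congr e1] at key
  rw [key, ← mul_assoc, mul_one_div_cancel ha0, one_mul, ← hinj.tsum_eq]
  · refine tsum_congr fun n => ?_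
    have : (((s + N * n : ℤ) : ZMod N) = (s : ZMod N)) := by simp
    rw [if_pos this, one_mul]
    have hI : Complex.I * Complex.I = -1 := Complex.I_mul_I
    have h1 : Complex.I * (-Complex.I * s / N) = (s : ℂ) / N := by
      linear_combination (-(s : ℂ) / N) * hI
    have h2 : -Real.pi / (-Complex.I * (2 * τ)) = -Complex.I * Real.pi / (2 * τ) := by
      rw [div_eq_div_iff (by simp [hτ0]) (by simp [hτ0])]
      linear_combination (-2 * Real.pi * τ) * hI
    rw [h1, h2]
    congr 1
    push_cast
    field_simp
    ring
  · intro n hn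
    have h : (n : ZMod N) = (s : ZMod N) := by
      by_contra h
      simp [h] at hn
    rw [ZMod.intCast_eq_intCast_iff_dvd_sub] at h
    obtain ⟨m, hm⟩ := h
    refine ⟨-m, ?_⟩
    change s + N * (-m) = n
    linarith

theorem addChar_map_sum {A M ι : Type*} [AddCommMonoid A] [CommMonoid M] (ψ : AddChar A M)
    (s : Finset ι) (f : ι → A) : ψ (∑ i ∈ s, f i) = ∏ i ∈ s, ψ (f i) :=
  map_prod ψ.toMonoidHom (fun i => Multiplicative.ofAdd (f i)) s

/-- Both sides are linear in F, so F may be the indicator of one class r; then both series factor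
over the coordinates and the one-dimensional formula applies d times. -/
theorem tsum_periodic_mul_cexp {d N : ℕ} [NeZero N] (F : (Fin d → ZMod N) → ℂ) {τ : ℂ}
    (hτ : 0 < τ.im) :
    ∑' x : Fin d → ℤ, F (fun i => (x i : ZMod N)) *
        Complex.exp (2 * Real.pi * Complex.I * (x ⬝ᵥ x : ℤ) * (-1 / (4 * (N : ℂ) ^ 2 * τ))) =
      ((-Complex.I * (2 * τ)) ^ (1 / 2 : ℂ)) ^ d *
        ∑' x : Fin d → ℤ, fourierFin F (fun i => (x i : ZMod N)) *
          Complex.exp (2 * Real.pi * Complex.I * (x ⬝ᵥ x : ℤ) * τ) := by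
  classical
  have hτ' : 0 < (-1 / (4 * (N : ℂ) ^ 2 * τ)).im := by
    have hN : (0 : ℝ) < N := Nat.cast_pos.2 (NeZero.pos N)
    have h0 : τ ≠ 0 := by
      rintro rfl
      simp at hτ
    have : (-1 / (4 * (N : ℂ) ^ 2 * τ)) = ((-(1 / (4 * (N : ℝ) ^ 2)) : ℝ) : ℂ) * τ⁻¹ := by
      push_cast
      field_simp
    rw [this, Complex.im_ofReal_mul, Complex.inv_im]
    have := Complex.normSq_pos.2 h0
    rw [neg_div, neg_mul_neg]
    positivity
  set w := -1 / (4 * (N : ℂ) ^ 2 * τ) with hw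
  let f (r : Fin d → ZMod N) (i : Fin d) (n : ℤ) : ℂ := (if (n : ZMod N) = r i then 1 else 0) *
    Complex.exp (2 * Real.pi * Complex.I * (n : ℂ) ^ 2 * w)
  let g (r : Fin d → ZMod N) (i : Fin d) (n : ℤ) : ℂ := ZMod.stdAddChar (-(r i * (n : ZMod N))) *
    Complex.exp (2 * Real.pi * Complex.I * (n : ℂ) ^ 2 * τ)
  have hf (r : Fin d → ZMod N) (i : Fin d) : Summable fun n => ‖f r i n‖ := by
    refine Summable.of_nonneg_of_le (fun n => norm_nonneg _) (fun n => ?_)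
      (summable_norm_cexp_sq hτ')
    simp only [f]
    split_ifs <;> simp
  have hg (r : Fin d → ZMod N) (i : Fin d) : Summable fun n => ‖g r i n‖ := by
    refine (summable_norm_cexp_sq hτ).congr fun n => ?_
    simp [g]
  have hf' := fun r => summable_norm_prod_and_tsum_prod (f r) (hf r)
  have hg' := fun r => summable_norm_prod_and_tsum_prod (g r) (hg r)
  have ef (x : Fin d → ℤ) : F (fun i => (x i : ZMod N)) *
      Complex.exp (2 * Real.pi * Complex.I * (x ⬝ᵥ x : ℤ) * w) =
      ∑ r, F r * ∏ i, f r i (x i) := by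
    rw [Finset.sum_eq_single (fun i => (x i : ZMod N))]
    · simp [f, cexp_dotProduct_self]
    · intro r _ hr
      obtain ⟨i, hi⟩ := Function.ne_iff.1 hr
      rw [Finset.prod_eq_zero (Finset.mem_univ i), mul_zero]
      simp [f, Ne.symm hi]
    · simp
  have eg (x : Fin d → ℤ) : fourierFin F (fun i => (x i : ZMod N)) *
      Complex.exp (2 * Real.pi * Complex.I * (x ⬝ᵥ x : ℤ) * τ) =
      ∑ r, F r * ∏ i, g r i (x i) := by
    rw [fourierFin, Finset.sum_mul]
    refine Finset.sum_congr rfl fun r _ => ?_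
    rw [mul_assoc, cexp_dotProduct_self, Finset.prod_mul_distrib, dotProduct,
      ← Finset.sum_neg_distrib, addChar_map_sum]
  simp only [ef, eg]
  rw [Summable.tsum_finsetSum fun r _ => (hf' r).1.of_norm.mul_left _,
    Summable.tsum_finsetSum fun r _ => (hg' r).1.of_norm.mul_left _, Finset.mul_sum]
  refine Finset.sum_congr rfl fun r _ => ?_
  rw [tsum_mul_left, tsum_mul_left, (hf' r).2, (hg' r).2]
  simp only [f, g, hw, tsum_indicator_cexp_sq _ hτ, Finset.prod_mul_distrib, Finset.prod_const,
    Finset.card_univ, Fintype.card_fin]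
  ring

/-! ### The finite Fourier transform of a quadratic phase modulo `p ^ 2` -/

section QuadraticPhase

variable {d p : ℕ}

/-- The reduction `ℤ/p²ℤ → ℤ/pℤ`. -/
def redSq (p : ℕ) : ZMod (p ^ 2) →+* ZMod p :=
  ZMod.castHom (dvd_pow_self p two_ne_zero) (ZMod p)

theorem exists_eq_mul_of_redSq_eq_zero {y : ZMod (p ^ 2)} (hy : redSq p y = 0) :
    ∃ m, y = p * m := by
  obtain ⟨n, rfl⟩ := ZMod.intCast_surjective y
  rw [map_intCast, ZMod.intCast_zmod_eq_zero_iff_dvd] at hy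
  obtain ⟨m, rfl⟩ := hy
  exact ⟨m, by simp⟩

theorem natCast_sq_eq_zero : (p : ZMod (p ^ 2)) ^ 2 = 0 := by
  rw [← Nat.cast_pow, ZMod.natCast_self]

theorem stdAddChar_natCast_mul [NeZero p] (y : ZMod (p ^ 2)) :
    (ZMod.stdAddChar ((p : ZMod (p ^ 2)) * y) : ℂ) = ZMod.stdAddChar (redSq p y) := by
  have hp : (p : ℂ) ≠ 0 := Nat.cast_ne_zero.2 (NeZero.ne p)
  obtain ⟨n, rfl⟩ := ZMod.intCast_surjective y
  have : (p : ZMod (p ^ 2)) * (n : ZMod (p ^ 2)) = ((p * n : ℤ) : ZMod (p ^ 2)) := by simp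
  rw [this, map_intCast (redSq p), ZMod.stdAddChar_coe, ZMod.stdAddChar_coe]
  congr 1
  push_cast
  field_simp

theorem sum_stdAddChar_dotProduct [NeZero p] (v : Fin d → ZMod p) :
    ∑ m : Fin d → ZMod p, (ZMod.stdAddChar (-(v ⬝ᵥ m)) : ℂ) = if v = 0 then (p : ℂ) ^ d else 0 := by
  classical
  have h1 (b : ZMod p) : ∑ m : ZMod p, (ZMod.stdAddChar (-(b * m)) : ℂ) =
      if b = 0 then (p : ℂ) else 0 := by
    have := AddChar.sum_mulShift (-b) (ZMod.isPrimitive_stdAddChar p)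
    simpa [mul_comm] using this
  have h2 (m : Fin d → ZMod p) : (ZMod.stdAddChar (-(v ⬝ᵥ m)) : ℂ) =
      ∏ i, ZMod.stdAddChar (-(v i * m i)) := by
    rw [dotProduct, ← Finset.sum_neg_distrib, addChar_map_sum]
  simp only [h2]
  rw [← Fintype.prod_sum fun i m => (ZMod.stdAddChar (-(v i * m)) : ℂ)]
  simp only [h1]
  split_ifs with hv
  · simp [hv]
  · obtain ⟨i, hi⟩ := Function.ne_iff.1 hv
    exact Finset.prod_eq_zero (Finset.mem_univ i) (if_neg hi)

/-- All fibres of a surjective homomorphism have the same size, here p^(2d) / p^d. -/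
theorem card_fiber_redSq [NeZero p] (r : Fin d → ZMod p) :
    (Finset.univ.filter fun x : Fin d → ZMod (p ^ 2) => (fun i => redSq p (x i)) = r).card =
      p ^ d := by
  let φ : (Fin d → ZMod (p ^ 2)) →+ (Fin d → ZMod p) :=
    (redSq p).toAddMonoidHom.compLeft (Fin d)
  have hφ : Function.Surjective φ := fun r =>
    ⟨fun i => ((r i).val : ZMod (p ^ 2)), funext fun i => by
      change redSq p _ = _
      simp⟩
  have hc (s : Fin d → ZMod p) : (Finset.univ.filter fun x => φ x = s).card =
      (Finset.univ.filter fun x => φ x = r).card :=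
    AddMonoidHom.card_fiber_eq_of_mem_range φ (hφ s) (hφ r)
  have h := Finset.card_eq_sum_card_fiberwise (f := φ) (s := Finset.univ) (t := Finset.univ)
    fun _ _ => Finset.mem_univ _
  simp only [hc, Finset.sum_const, Finset.card_univ, Fintype.card_fun, ZMod.card, Fintype.card_fin,
    smul_eq_mul] at h
  rw [← pow_mul, mul_comm 2 d, pow_mul, sq] at h
  exact (Nat.eq_of_mul_eq_mul_left (pow_pos (NeZero.pos p) d) h).symm

/-- No Gauss sum has to be evaluated. Since p² = 0, replacing x by x + pM multiplies the summand by
a character of M mod p, trivial exactly when 2j'x + ξ ≡ 0, that is x ≡ 2jξ mod p because 4jj' ≡ -1.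
All other classes cancel by orthogonality; on the surviving class, of size p^d, the summand is
constant. -/
theorem fourierFin_quadraticPhase [Fact p.Prime] (h : (Fin d → ZMod p) → ℂ) {j j' : ℤ}
    (hj : 4 * (j : ZMod p) * j' + 1 = 0) (ξ : Fin d → ℤ) :
    fourierFin (p := p ^ 2) (fun x => h (fun i => redSq p (x i)) *
        ZMod.stdAddChar (-((j' : ZMod (p ^ 2)) * (x ⬝ᵥ x)))) (fun i => (ξ i : ZMod (p ^ 2))) =
      (p : ℂ) ^ d * (h (fun i => 2 * j * ξ i) *
        ZMod.stdAddChar (((-(4 * j' * j ^ 2 + 2 * j) * (ξ ⬝ᵥ ξ) : ℤ) : ZMod (p ^ 2)))) := by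
  classical
  have hp0 : (p : ℂ) ^ d ≠ 0 :=
    pow_ne_zero _ (Nat.cast_ne_zero.2 (Fact.out : p.Prime).ne_zero)
  let Ξ : Fin d → ZMod (p ^ 2) := fun i => (ξ i : ZMod (p ^ 2))
  let ρ : (Fin d → ZMod (p ^ 2)) → (Fin d → ZMod p) := fun x i => redSq p (x i)
  have hρ (x y : Fin d → ZMod (p ^ 2)) : redSq p (x ⬝ᵥ y) = ρ x ⬝ᵥ ρ y := by
    simp [ρ, dotProduct]
  let T : (Fin d → ZMod (p ^ 2)) → ℂ := fun x =>
    h (ρ x) * ZMod.stdAddChar (-((j' : ZMod (p ^ 2)) * (x ⬝ᵥ x))) * ZMod.stdAddChar (-(x ⬝ᵥ Ξ))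
  have hT (x M : Fin d → ZMod (p ^ 2)) : T (x + (p : ZMod (p ^ 2)) • M) =
      T x * ZMod.stdAddChar (-((2 * (j' : ZMod p)) • ρ x + ρ Ξ) ⬝ᵥ ρ M) := by
    have e1 : ρ (x + (p : ZMod (p ^ 2)) • M) = ρ x := by
      funext i
      simp [ρ]
    have e2 : -((2 * (j' : ZMod p)) • ρ x + ρ Ξ) ⬝ᵥ ρ M =
        redSq p (-((2 * (j' : ZMod (p ^ 2))) • x + Ξ) ⬝ᵥ M) := by
      rw [hρ]
      congr 1
      funext i
      simp [ρ, map_ofNat (redSq p)]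
    simp only [T, e1]
    rw [e2, ← stdAddChar_natCast_mul, mul_assoc, mul_assoc, mul_assoc, ← AddChar.map_add_eq_mul,
      ← AddChar.map_add_eq_mul, ← AddChar.map_add_eq_mul]
    congr 2
    simp only [add_dotProduct, dotProduct_add, smul_dotProduct, dotProduct_smul, neg_dotProduct,
      smul_eq_mul, dotProduct_comm M x, dotProduct_comm M Ξ]
    linear_combination (-(j' : ZMod (p ^ 2)) * (M ⬝ᵥ M)) * natCast_sq_eq_zero (p := p)
  have hcond (x : Fin d → ZMod (p ^ 2)) :
      -((2 * (j' : ZMod p)) • ρ x + ρ Ξ) = 0 ↔ ρ x = fun i => 2 * (j : ZMod p) * ξ i := by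
    have hΞ (i : Fin d) : ρ Ξ i = ξ i := by simp [ρ, Ξ]
    rw [neg_eq_zero]
    constructor
    · intro hx
      funext i
      have := congrFun hx i
      simp only [Pi.add_apply, Pi.smul_apply, smul_eq_mul, hΞ, Pi.zero_apply] at this
      linear_combination ρ x i * hj - 2 * (j : ZMod p) * this
    · intro hx
      funext i
      simp only [Pi.add_apply, Pi.smul_apply, smul_eq_mul, hΞ, Pi.zero_apply, hx]
      linear_combination (ξ i : ZMod p) * hj
  have hsum : (p : ℂ) ^ d * ∑ x, T x =
      (p : ℂ) ^ d * ∑ x with ρ x = fun i => 2 * (j : ZMod p) * ξ i, T x := by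
    -- The sum is invariant under translation by pm; summing over all m brings in the orthogonality
    -- relation.
    have h1 (m : Fin d → ZMod p) : ∑ x, T x =
        ∑ x, T x * ZMod.stdAddChar (-((2 * (j' : ZMod p)) • ρ x + ρ Ξ) ⬝ᵥ m) := by
      have hm : ρ (fun i => ((m i).val : ZMod (p ^ 2))) = m := by
        funext i
        simp [ρ]
      rw [← Equiv.sum_comp (Equiv.addRight ((p : ZMod (p ^ 2)) •
        (fun i => ((m i).val : ZMod (p ^ 2)))))]
      refine Finset.sum_congr rfl fun x _ => ?_
      rw [Equiv.coe_addRight, hT, hm]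
    have h2 : ∑ m : Fin d → ZMod p, ∑ x, T x = (p : ℂ) ^ d * ∑ x, T x := by
      simp
    rw [← h2, Finset.sum_congr rfl fun m _ => h1 m, Finset.sum_comm, Finset.mul_sum,
      Finset.sum_filter]
    refine Finset.sum_congr rfl fun x _ => ?_
    rw [← Finset.mul_sum]
    have := sum_stdAddChar_dotProduct ((2 * (j' : ZMod p)) • ρ x + ρ Ξ)
    simp only [neg_dotProduct, this, ← hcond, neg_eq_zero]
    split_ifs <;> ring
  -- A lift of the surviving class at which the constant value of the summand is read off: its phase
  -- is -j'(2j)²|ξ|² - 2j|ξ|².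
  let x₀ : Fin d → ZMod (p ^ 2) := fun i => ((2 * j * ξ i : ℤ) : ZMod (p ^ 2))
  have hx₀ : ρ x₀ = fun i => 2 * (j : ZMod p) * ξ i := by
    funext i
    simp [ρ, x₀, map_ofNat (redSq p)]
  have hconst (x : Fin d → ZMod (p ^ 2)) (hx : ρ x = fun i => 2 * (j : ZMod p) * ξ i) :
      T x = T x₀ := by
    have hM (i : Fin d) : ∃ m, x i - x₀ i = p * m := by
      refine exists_eq_mul_of_redSq_eq_zero ?_
      rw [map_sub, sub_eq_zero]
      exact congrFun (hx.trans hx₀.symm) i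
    choose M hM using hM
    have : x = x₀ + (p : ZMod (p ^ 2)) • M := by
      funext i
      simp [← hM]
    rw [this, hT, (hcond x₀).2 hx₀]
    simp
  have hS : fourierFin (p := p ^ 2) (fun x => h (fun i => redSq p (x i)) *
      ZMod.stdAddChar (-((j' : ZMod (p ^ 2)) * (x ⬝ᵥ x)))) Ξ = ∑ x, T x := rfl
  rw [hS, mul_left_cancel₀ hp0 hsum, Finset.sum_congr rfl fun x hx =>
    hconst x (Finset.mem_filter.1 hx).2, Finset.sum_const, card_fiber_redSq, nsmul_eq_mul]
  push_cast
  congr 1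
  simp only [T, hx₀]
  rw [mul_assoc, ← AddChar.map_add_eq_mul]
  congr 2
  simp only [x₀, Ξ, dotProduct]
  push_cast
  simp only [Finset.mul_sum, ← Finset.sum_neg_distrib, ← Finset.sum_add_distrib]
  refine Finset.sum_congr rfl fun i _ => ?_
  ring

end QuadraticPhase

/-! ### The theta series are holomorphic -/

section Theta

variable {d p : ℕ} [NeZero p]

theorem exists_norm_le {α β : Type*} [Finite β] (f : β → ℂ) (c : α → β) :
    ∃ C, ∀ x, ‖f (c x)‖ ≤ C := by
  obtain ⟨C, hC⟩ := (Set.finite_range fun b => ‖f b‖).bddAbove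
  exact ⟨C, fun x => hC ⟨c x, rfl⟩⟩

theorem im_sub_div_sq_pos {τ : ℂ} (hτ : 0 < τ.im) (n : ℕ) :
    0 < ((τ - n) / (p : ℂ) ^ 2).im := by
  have hp : (0 : ℝ) < p := Nat.cast_pos.2 (NeZero.pos p)
  have : (τ - n) / (p : ℂ) ^ 2 = (((p : ℝ) ^ 2)⁻¹ : ℝ) * (τ - n) := by
    push_cast
    field_simp
  rw [this, Complex.im_ofReal_mul]
  simp only [Complex.sub_im, Complex.natCast_im, sub_zero]
  positivity

theorem summable_thetaTerm (j : OnePoint (ZMod p)) (f : (Fin d → ZMod p) → ℂ) (τ : ℍ) :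
    Summable (thetaTerm j f τ) := by
  cases j with
  | infty =>
    obtain ⟨C, hC⟩ := exists_norm_le (fourierFin f) fun (x : Fin d → ℤ) i => (x i : ZMod p)
    exact summable_mul_cexp_dotProduct hC τ.im_pos
  | coe j =>
    obtain ⟨C, hC⟩ := exists_norm_le f fun (x : Fin d → ℤ) i => (x i : ZMod p)
    exact summable_mul_cexp_dotProduct hC (im_sub_div_sq_pos τ.im_pos j.val)

theorem theta_mem_Hol (j : OnePoint (ZMod p)) (f : (Fin d → ZMod p) → ℂ) : theta j f ∈ Hol := by
  change MDifferentiable 𝓘(ℂ) 𝓘(ℂ) (theta j f)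
  rw [UpperHalfPlane.mdifferentiable_iff]
  cases j with
  | infty =>
    obtain ⟨C, hC⟩ := exists_norm_le (fourierFin f) fun (x : Fin d → ℤ) i => (x i : ZMod p)
    refine (differentiableOn_tsum_cexp_dotProduct hC).congr fun w hw => ?_
    simp [theta, thetaTerm, ofComplex_apply_of_im_pos hw]
  | coe j =>
    obtain ⟨C, hC⟩ := exists_norm_le f fun (x : Fin d → ℤ) i => (x i : ZMod p)
    have h := (differentiableOn_tsum_cexp_dotProduct hC).comp
      (f := fun w : ℂ => (w - (j.val : ℂ)) / (p : ℂ) ^ 2) (s := {w | 0 < w.im}) (by fun_prop)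
      fun w hw => im_sub_div_sq_pos hw j.val
    refine h.congr fun w hw => ?_
    simp [theta, thetaTerm, ofComplex_apply_of_im_pos hw]

theorem thetaTerm_add (j : OnePoint (ZMod p)) (f g : (Fin d → ZMod p) → ℂ) (τ : ℍ)
    (x : Fin d → ℤ) : thetaTerm j (f + g) τ x = thetaTerm j f τ x + thetaTerm j g τ x := by
  cases j with
  | infty => simp [thetaTerm, fourierFin, add_mul, Finset.sum_add_distrib]
  | coe j => simp [thetaTerm, add_mul]

theorem thetaTerm_smul (j : OnePoint (ZMod p)) (c : ℂ) (f : (Fin d → ZMod p) → ℂ) (τ : ℍ)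
    (x : Fin d → ℤ) : thetaTerm j (c • f) τ x = c * thetaTerm j f τ x := by
  cases j with
  | infty => simp [thetaTerm, fourierFin, Finset.mul_sum, mul_assoc, Finset.sum_mul]
  | coe j => simp [thetaTerm, mul_assoc]

/-- The linear map `f ↦ θ_f^j`. -/
def thetaLin (d : ℕ) {p : ℕ} [NeZero p] (j : OnePoint (ZMod p)) : EvenFun d p →ₗ[ℂ] Hol where
  toFun f := ⟨theta j f.1, theta_mem_Hol j f.1⟩
  map_add' f g := Subtype.ext (funext fun τ => by
    simp only [theta, Submodule.coe_add, Pi.add_apply, thetaTerm_add]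
    exact (summable_thetaTerm j f.1 τ).tsum_add (summable_thetaTerm j g.1 τ))
  map_smul' c f := Subtype.ext (funext fun τ => by
    simp only [theta, Submodule.coe_smul, Pi.smul_apply, thetaTerm_smul, smul_eq_mul,
      RingHom.id_apply]
    exact tsum_mul_left)

end Theta

/-! ### The slash operators of the generators -/

/-- Evaluating at gτ replaces the factor of g⁻¹ by that of g, which is known explicitly on the
generators. -/
theorem slash_smul (m : ℤ) (u : ℂ) (g : Lam) (ψ : ℍ → ℂ) (τ : ℍ) :
    slash m u g ψ (g • τ) = halfFactor g τ ^ m * (realDet g : ℂ) ^ (-u) * ψ τ := by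
  have h : halfFactor g⁻¹ (g • τ) * halfFactor g τ = 1 := by
    rw [← halfFactor_spec.cocycle, inv_mul_cancel, halfFactor_spec.map_one]
  rw [slash, inv_smul_smul, eq_inv_of_mul_eq_one_left h, inv_zpow, zpow_neg, inv_inv]

theorem slash_alpha_smul (m : ℤ) (u : ℂ) (ψ : ℍ → ℂ) (τ : ℍ) :
    slash m u lamAlpha ψ (lamAlpha • τ) = ψ τ := by
  rw [slash_smul, halfFactor_spec.alpha, realDet_alpha]
  simp

/-- The parameter `u` with `4 ^ (-u) = (i / 2) ^ (d / 2)`. -/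
def weightParam (d : ℕ) : ℂ := -(d * (Complex.log (Complex.I / 2) * (1 / 2)) / Complex.log 4)

theorem four_cpow_weightParam (d : ℕ) :
    (4 : ℂ) ^ (-weightParam d) = ((Complex.I / 2) ^ (1 / 2 : ℂ)) ^ d := by
  have hl : Complex.log 4 ≠ 0 := by
    have : Complex.log 4 = (Real.log 4 : ℝ) := by
      rw [Complex.ofReal_log (by norm_num)]
      norm_num
    rw [this]
    exact_mod_cast (Real.log_pos (by norm_num)).ne'
  rw [weightParam, neg_neg, Complex.cpow_def_of_ne_zero (by norm_num),
    mul_div_cancel₀ _ hl, Complex.exp_nat_mul, Complex.cpow_def_of_ne_zero (by simp)]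

/-- The choice of u supplies (i/2)^(d/2), so the automorphy factor becomes exactly the factor of
Poisson summation. -/
theorem slash_gamma_smul (d : ℕ) (ψ : ℍ → ℂ) (τ : ℍ) :
    slash d (weightParam d) lamGamma ψ (lamGamma • τ) =
      ((-Complex.I * (2 * (τ : ℂ))) ^ (1 / 2 : ℂ)) ^ d * ψ τ := by
  rw [slash_smul, halfFactor_spec.gamma, realDet_gamma, zpow_natCast, Complex.ofReal_ofNat,
    four_cpow_weightParam, ← cpow_gamma, mul_pow]
  ring

theorem slash_ext {m : ℤ} {u : ℂ} {g : Lam} {ψ ψ' : ℍ → ℂ}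
    (h : ∀ τ : ℍ, slash m u g ψ (g • τ) = ψ' (g • τ)) : slash m u g ψ = ψ' := by
  funext τ
  simpa using h (g⁻¹ • τ)

/-! ### The action of the generators on the theta series -/

section Generators

variable {d p : ℕ} [Fact p.Prime]

theorem theta_alpha_infty (f : (Fin d → ZMod p) → ℂ) (τ : ℍ) :
    theta ∞ f (lamAlpha • τ) = theta ∞ f τ := by
  refine tsum_congr fun x => ?_
  simp only [thetaTerm, coe_lamAlpha_smul]
  congr 1
  rw [mul_add, mul_one, Complex.exp_add, mul_comm (2 * (Real.pi : ℂ) * Complex.I) ((x ⬝ᵥ x : ℤ) : ℂ),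
    Complex.exp_int_mul_two_pi_mul_I, mul_one]

theorem theta_alpha {j : ℕ} (hj : j ≤ p - 2) (f : (Fin d → ZMod p) → ℂ) (τ : ℍ) :
    theta (((j : ZMod p) + 1 : ZMod p) : OnePoint (ZMod p)) f (lamAlpha • τ) =
      theta ((j : ZMod p) : OnePoint (ZMod p)) f τ := by
  refine tsum_congr fun x => ?_
  simp only [thetaTerm, coe_lamAlpha_smul, (val_succ_of_le p hj).1, (val_succ_of_le p hj).2]
  push_cast
  congr 3
  ring

/-- Since τ + 1 = (τ - (p - 1)) + p, passing from index p - 1 to 0 adds p/p² = 1/p to the argument,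
and L cancels the resulting e(|x|²/p). -/
theorem theta_alpha_last (f : EvenFun d p) (τ : ℍ) :
    theta ((0 : ZMod p) : OnePoint (ZMod p))
      ((opL d p : EvenFun d p →ₗ[ℂ] EvenFun d p) f).1 (lamAlpha • τ) =
      theta (((p - 1 : ℕ) : ZMod p) : OnePoint (ZMod p)) f.1 τ := by
  have h2 := (Fact.out : p.Prime).two_le
  have hp : (p : ℂ) ≠ 0 := Nat.cast_ne_zero.2 (by omega)
  refine tsum_congr fun x => ?_
  have hL (y : Fin d → ZMod p) : ((opL d p : EvenFun d p →ₗ[ℂ] EvenFun d p) f).1 y =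
      ZMod.stdAddChar (-(y ⬝ᵥ y)) * f.1 y := rfl
  have hx : -((fun i => (x i : ZMod p)) ⬝ᵥ fun i => (x i : ZMod p)) =
      ((-(x ⬝ᵥ x) : ℤ) : ZMod p) := by
    simp [dotProduct]
  simp only [thetaTerm, coe_lamAlpha_smul, hL, hx, ZMod.stdAddChar_coe, ZMod.val_zero]
  rw [ZMod.val_cast_of_lt (by omega), mul_comm (Complex.exp _), mul_assoc, ← Complex.exp_add,
    Nat.cast_sub (by omega)]
  congr 2
  push_cast
  field_simp
  ring

/-- Poisson summation with N = p, since γτ/p² = -1/(4p²τ). -/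
theorem theta_gamma_infty (f : (Fin d → ZMod p) → ℂ) (τ : ℍ) :
    theta ((0 : ZMod p) : OnePoint (ZMod p)) f (lamGamma • τ) =
      ((-Complex.I * (2 * (τ : ℂ))) ^ (1 / 2 : ℂ)) ^ d * theta ∞ f τ := by
  have hp : (p : ℂ) ≠ 0 := Nat.cast_ne_zero.2 (Fact.out : p.Prime).ne_zero
  have hτ := τ.ne_zero
  rw [theta, theta]
  simp only [thetaTerm]
  rw [← tsum_periodic_mul_cexp f τ.im_pos]
  refine tsum_congr fun x => ?_
  rw [coe_lamGamma_smul, ZMod.val_zero]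
  congr 3
  push_cast
  field_simp
  ring

/-- The two bases are reciprocal and lie in the right half-plane, away from the branch cut, so their
principal roots are reciprocal. -/
theorem cpow_half_mul_cpow_half_gamma (τ : ℍ) :
    (-Complex.I * (2 * ((lamGamma • τ : ℍ) : ℂ))) ^ (1 / 2 : ℂ) *
      (-Complex.I * (2 * (τ : ℂ))) ^ (1 / 2 : ℂ) = 1 := by
  have hτ := τ.ne_zero
  have hre : 0 < (-Complex.I * (2 * (τ : ℂ))).re := by simpa using τ.im_pos
  have h : -Complex.I * (2 * ((lamGamma • τ : ℍ) : ℂ)) = (-Complex.I * (2 * (τ : ℂ)))⁻¹ := by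
    rw [coe_lamGamma_smul]
    refine eq_inv_of_mul_eq_one_left ?_
    field_simp
    linear_combination (-4 : ℂ) * Complex.I_sq
  have h0 : -Complex.I * (2 * (τ : ℂ)) ≠ 0 := by simpa using hτ
  rw [h, Complex.inv_cpow, inv_mul_cancel₀]
  · rw [Complex.cpow_ne_zero_iff]
    exact Or.inl h0
  · intro hpi
    have := Complex.arg_eq_pi_iff.1 hpi
    linarith [this.1]

/-- As γ² acts trivially on ℍ, this is the formula for ∞ evaluated at γτ; Fourier inversion is not
needed. -/
theorem theta_gamma_zero (f : (Fin d → ZMod p) → ℂ) (τ : ℍ) :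
    theta ∞ f (lamGamma • τ) = ((-Complex.I * (2 * (τ : ℂ))) ^ (1 / 2 : ℂ)) ^ d *
      theta ((0 : ZMod p) : OnePoint (ZMod p)) f τ := by
  have hγ : lamGamma • lamGamma • τ = τ := by
    refine UpperHalfPlane.ext ?_
    rw [coe_lamGamma_smul, coe_lamGamma_smul]
    have hτ := τ.ne_zero
    field_simp
  have h := theta_gamma_infty f (lamGamma • τ)
  rw [hγ] at h
  rw [h, ← mul_assoc, ← mul_pow, mul_comm (_ ^ (1 / 2 : ℂ)), cpow_half_mul_cpow_half_gamma,
    one_pow, one_mul]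

/-- A positive real factor leaves the principal root. This absorbs the p^d coming from the finite
Fourier transform mod p². -/
theorem cpow_half_div_sq {z : ℂ} (hz : z ≠ 0) {n : ℕ} (hn : n ≠ 0) :
    (n : ℂ) * (z / (n : ℂ) ^ 2) ^ (1 / 2 : ℂ) = z ^ (1 / 2 : ℂ) := by
  have hn' : (0 : ℝ) < n := Nat.cast_pos.2 (Nat.pos_of_ne_zero hn)
  have hnC : (n : ℂ) ≠ 0 := Nat.cast_ne_zero.2 hn
  have hw : z / (n : ℂ) ^ 2 ≠ 0 := div_ne_zero hz (pow_ne_zero _ hnC)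
  have e : z = (((n : ℝ) ^ 2 : ℝ) : ℂ) * (z / (n : ℂ) ^ 2) := by
    push_cast
    field_simp
  conv_rhs => rw [e]
  rw [Complex.cpow_def_of_ne_zero hw, Complex.cpow_def_of_ne_zero (e ▸ hz),
    Complex.log_ofReal_mul (by positivity) hw, add_mul, Complex.exp_add, Real.log_pow]
  congr 1
  rw [← Complex.ofReal_natCast n]
  push_cast
  rw [mul_comm (2 : ℂ), mul_assoc]
  norm_num
  rw [← Complex.ofReal_natCast n, ← Complex.ofReal_log hn'.le, ← Complex.ofReal_exp,
    Real.exp_log hn']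

variable [Fact (p ≠ 2)]

theorem theta_gamma_some {j j' : ℕ} {k : ℤ} (hj : j ≤ p - 1) (hj' : j' ≤ p - 1)
    (h : 4 * (j : ℤ) * j' + 1 = p * k) {g : Del p} (hm : delMult g = -k * j')
    (hs : delScale g = 2 * j') (f : EvenFun d p) (τ : ℍ) :
    theta ((j' : ZMod p) : OnePoint (ZMod p))
      ((delRep d p g : EvenFun d p →ₗ[ℂ] EvenFun d p) f).1 (lamGamma • τ) =
      ((-Complex.I * (2 * (τ : ℂ))) ^ (1 / 2 : ℂ)) ^ d *
        theta ((j : ZMod p) : OnePoint (ZMod p)) f.1 τ := by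
  have h2 := (Fact.out : p.Prime).two_le
  have hp : (p : ℂ) ≠ 0 := Nat.cast_ne_zero.2 (by omega)
  have hp0 : p ≠ 0 := by omega
  have hτ := τ.ne_zero
  have hz := congrArg (fun n : ℤ => (n : ZMod p)) h
  push_cast at hz
  rw [ZMod.natCast_self, zero_mul] at hz
  set F := ((delRep d p g : EvenFun d p →ₗ[ℂ] EvenFun d p) f).1 with hF
  have hτ' : 0 < ((τ : ℂ) / (p : ℂ) ^ 2).im := by
    simpa using im_sub_div_sq_pos (p := p) τ.im_pos 0
  -- At the point τ/p² with period p² the dual argument is -1/(4p⁴ · τ/p²) = γτ/p²; the shift by j'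
  -- is moved into the periodic coefficient.
  have key := tsum_periodic_mul_cexp (N := p ^ 2) (fun x : Fin d → ZMod (p ^ 2) =>
    F (fun i => redSq p (x i)) *
      ZMod.stdAddChar (-(((j' : ℤ) : ZMod (p ^ 2)) * (x ⬝ᵥ x)))) hτ'
  simp only [fourierFin_quadraticPhase F (j := j) (j' := j') (by exact_mod_cast hz)] at key
  have hdot (x : Fin d → ℤ) : ((fun i => (x i : ZMod p)) ⬝ᵥ fun i => (x i : ZMod p)) =
      ((x ⬝ᵥ x : ℤ) : ZMod p) := by
    simp [dotProduct]
  have hdot' (x : Fin d → ℤ) :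
      ((fun i => (x i : ZMod (p ^ 2))) ⬝ᵥ fun i => (x i : ZMod (p ^ 2))) =
      ((x ⬝ᵥ x : ℤ) : ZMod (p ^ 2)) := by
    simp [dotProduct]
  have hleft (x : Fin d → ℤ) : thetaTerm ((j' : ZMod p) : OnePoint (ZMod p)) F (lamGamma • τ) x =
      F (fun i => redSq p (x i : ZMod (p ^ 2))) * ZMod.stdAddChar (-(((j' : ℤ) : ZMod (p ^ 2)) *
        ((fun i => (x i : ZMod (p ^ 2))) ⬝ᵥ fun i => (x i : ZMod (p ^ 2))))) *
      Complex.exp (2 * Real.pi * Complex.I * (x ⬝ᵥ x : ℤ) *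
        (-1 / (4 * ((p ^ 2 : ℕ) : ℂ) ^ 2 * ((τ : ℂ) / (p : ℂ) ^ 2)))) := by
    have e : -(((j' : ℤ) : ZMod (p ^ 2)) * ((x ⬝ᵥ x : ℤ) : ZMod (p ^ 2))) =
        ((-(j' * (x ⬝ᵥ x)) : ℤ) : ZMod (p ^ 2)) := by
      push_cast
      ring
    simp only [thetaTerm, coe_lamGamma_smul, map_intCast]
    rw [ZMod.val_cast_of_lt (by omega), hdot', e, ZMod.stdAddChar_coe, mul_assoc (F _),
      ← Complex.exp_add]
    congr 2
    push_cast
    field_simp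
    ring
  -- The scalings 2j and 2j' compose to 4jj' ≡ -1, and f is even; likewise -kj'(2j)² ≡ kj.
  have hFx (x : Fin d → ℤ) : F (fun i => 2 * ((j : ℤ) : ZMod p) * (x i : ZMod p)) =
      ZMod.stdAddChar ((k * j * (x ⬝ᵥ x) : ℤ) : ZMod p) * f.1 (fun i => (x i : ZMod p)) := by
    rw [hF, delRep_apply, hm, hs, ← f.2 fun i => (x i : ZMod p)]
    congr 1
    · congr 1
      have : (fun i => 2 * ((j : ℤ) : ZMod p) * (x i : ZMod p)) =
        (2 * (j : ZMod p)) • fun i => (x i : ZMod p) := by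
          funext i
          simp
      rw [this, smul_dotProduct, dotProduct_smul, hdot]
      push_cast
      simp only [smul_eq_mul]
      linear_combination (-k * j * ((x ⬝ᵥ x : ℤ) : ZMod p)) * hz
    · refine congrArg f.1 (funext fun i => ?_)
      simp only [Pi.smul_apply, smul_eq_mul, Pi.neg_apply]
      push_cast
      linear_combination (x i : ZMod p) * hz
  -- By the exact relation 4jj' + 1 = pk one has 4j'j² + 2j = pkj + j. Mod p² the first term gives
  -- e(-kj|x|²/p), which cancels the phase of F, and the second is the shift by j in θ^j.
  have hright (x : Fin d → ℤ) : (p : ℂ) ^ d * (F (fun i => 2 * ((j : ℤ) : ZMod p) * (x i : ZMod p)) *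
      ZMod.stdAddChar ((-(4 * j' * j ^ 2 + 2 * j) * (x ⬝ᵥ x) : ℤ) : ZMod (p ^ 2))) *
      Complex.exp (2 * Real.pi * Complex.I * (x ⬝ᵥ x : ℤ) * ((τ : ℂ) / (p : ℂ) ^ 2)) =
      (p : ℂ) ^ d * thetaTerm ((j : ZMod p) : OnePoint (ZMod p)) f.1 τ x := by
    have hC := congrArg (fun n : ℤ => (n : ℂ)) h
    push_cast at hC
    simp only [thetaTerm]
    rw [hFx, ZMod.val_cast_of_lt (by omega), ZMod.stdAddChar_coe, ZMod.stdAddChar_coe,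
      mul_comm (Complex.exp _) (f.1 _), mul_assoc, mul_assoc, mul_assoc, ← Complex.exp_add,
      ← Complex.exp_add]
    congr 3
    push_cast
    field_simp
    linear_combination (-((x ⬝ᵥ x : ℤ) : ℂ) * j) * hC
  rw [theta, theta, tsum_congr hleft, key, tsum_congr hright, tsum_mul_left, ← mul_assoc,
    ← mul_pow]
  congr 2
  have := cpow_half_div_sq (z := -Complex.I * (2 * (τ : ℂ))) (by simpa using hτ) hp0
  have e : -Complex.I * (2 * ((τ : ℂ) / (p : ℂ) ^ 2)) =
      -Complex.I * (2 * (τ : ℂ)) / (p : ℂ) ^ 2 := by ring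
  rw [e, mul_comm, this]

end Generators

/-! ### The cocycle with values in `GL(V_p)` -/

section Values

theorem detExp_eq_natCast {p : ℕ} {g : Del p} {a b c e : ZHalf} {n : ℕ}
    (hg : g.1.val = !![a, b; c, e]) (h : a * e - b * c = 4 ^ n) : detExp g = n := by
  refine detExp_eq_of_det (Units.ext ?_)
  rw [Matrix.GeneralLinearGroup.val_det_apply, hg, Matrix.det_fin_two_of, h, zpow_natCast,
    Units.val_pow_eq_pow_val]
  rfl

theorem opL_zpow_apply {d p : ℕ} [NeZero p] (n : ℤ) (f : EvenFun d p) (x : Fin d → ZMod p) :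
    (((opL d p ^ n : LinearMap.GeneralLinearGroup ℂ (EvenFun d p)) :
      EvenFun d p →ₗ[ℂ] EvenFun d p) f).1 x = ZMod.stdAddChar (-((n : ZMod p) * (x ⬝ᵥ x))) * f.1 x := by
  induction n generalizing f with
  | zero => simp
  | succ n ih =>
    rw [zpow_add_one, Units.val_mul, Module.End.mul_apply, ih]
    change _ * (ZMod.stdAddChar (-(x ⬝ᵥ x)) * f.1 x) = _
    rw [← mul_assoc, ← AddChar.map_add_eq_mul]
    congr 2
    push_cast
    ring
  | pred n ih =>
    rw [zpow_sub_one, Units.val_mul, Module.End.mul_apply, ih]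
    change _ * (ZMod.stdAddChar (x ⬝ᵥ x) * f.1 x) = _
    rw [← mul_assoc, ← AddChar.map_add_eq_mul]
    congr 2
    push_cast
    ring

variable (d p : ℕ) [Fact p.Prime] [Fact (p ≠ 2)]

/-- The cocycle `σ = π_Δ ∘ φ`. -/
def repCocycle (g : Lam) (j : OnePoint (ZMod p)) :
    LinearMap.GeneralLinearGroup ℂ (EvenFun d p) :=
  delRep d p (delCocycle p g j)

theorem isCocycle_repCocycle : IsCocycle (repCocycle d p) := by
  intro g h x
  simp only [repCocycle, isCocycle_delCocycle p g h x, map_mul]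

theorem repCocycle_alpha {j : ℕ} (hj : j ≤ p - 2) :
    repCocycle d p lamAlpha ((j : ZMod p) : OnePoint (ZMod p)) = 1 := by
  rw [repCocycle, delCocycle_alpha p hj, map_one]

theorem repCocycle_alpha_last :
    repCocycle d p lamAlpha (((p - 1 : ℕ) : ZMod p) : OnePoint (ZMod p)) = opL d p := by
  have hv := delCocycle_alpha_last p
  refine Units.ext (LinearMap.ext fun f => Subtype.ext (funext fun x => ?_))
  rw [repCocycle, delRep_apply]
  generalize delCocycle p lamAlpha (((p - 1 : ℕ) : ZMod p) : OnePoint (ZMod p)) = g at hv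
  have hn : detExp g = (0 : ℕ) := detExp_eq_natCast hv (by ring)
  have h4 := four_ne_zero_zmod p
  have hs : delScale g = 1 := by simp [delScale, hn, redEntry, hv]
  have hm : delMult g = -1 := by
    simp [delMult, hn, redEntry, hv, map_ofNat (ZHalf.toZMod p), h4]
  rw [hs, hm, one_smul, neg_one_mul]
  rfl

/-- The matrix (1 0; p 1) reduces to the identity mod p, which is all the representation sees
besides the determinant. -/
theorem repCocycle_alpha_infty : repCocycle d p lamAlpha ∞ = 1 := by
  have hv := delCocycle_alpha_infty p
  refine Units.ext (LinearMap.ext fun f => Subtype.ext (funext fun x => ?_))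
  rw [repCocycle, delRep_apply]
  generalize delCocycle p lamAlpha ∞ = g at hv
  have hn : detExp g = (0 : ℕ) := detExp_eq_natCast hv (by ring)
  have hs : delScale g = 1 := by simp [delScale, hn, redEntry, hv]
  have hm : delMult g = 0 := by simp [delMult, redEntry, hv]
  rw [hs, hm]
  simp

theorem repCocycle_gamma_infty : repCocycle d p lamGamma ∞ = 1 := by
  rw [repCocycle, delCocycle_gamma_infty, map_one]

/-- The scalar matrix -4 has determinant 4², so it rescales x by -4/2² = -1, which is trivial on
even functions. -/
theorem repCocycle_gamma_zero :
    repCocycle d p lamGamma ((0 : ZMod p) : OnePoint (ZMod p)) = 1 := by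
  have hv := delCocycle_gamma_zero p
  refine Units.ext (LinearMap.ext fun f => Subtype.ext (funext fun x => ?_))
  rw [repCocycle, delRep_apply]
  generalize delCocycle p lamGamma ((0 : ZMod p) : OnePoint (ZMod p)) = g at hv
  have hn : detExp g = (2 : ℕ) := detExp_eq_natCast hv (by ring)
  have h2 := two_ne_zero_zmod p
  have hs : delScale g = -1 := by
    simp only [delScale, hn, redEntry, hv]
    simp only [Matrix.of_apply, Matrix.cons_val', Matrix.cons_val_zero, map_neg,
      map_ofNat (ZHalf.toZMod p), zpow_natCast]
    field_simp
    norm_num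
  have hm : delMult g = 0 := by simp [delMult, redEntry, hv]
  rw [hs, hm]
  simp [f.2 x]

variable {p}

theorem delScale_delMult_gamma {j j' : ℕ} {k : ℤ} (hj : j ≤ p - 1) (hj' : j' ≤ p - 1)
    (h : 4 * (j : ℤ) * j' + 1 = p * k) :
    delScale (delCocycle p lamGamma ((j : ZMod p) : OnePoint (ZMod p))) = 2 * j' ∧
      delMult (delCocycle p lamGamma ((j : ZMod p) : OnePoint (ZMod p))) = -k * j' := by
  have hv := delCocycle_gamma_some p hj hj' h
  generalize delCocycle p lamGamma ((j : ZMod p) : OnePoint (ZMod p)) = g at hv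
  have hz := congrArg (fun n : ℤ => (n : ZHalf)) h
  push_cast at hz
  have hn : detExp g = (1 : ℕ) :=
    detExp_eq_natCast hv (by linear_combination (-4 : ZHalf) * hz)
  have h2 := two_ne_zero_zmod p
  have h4 := four_ne_zero_zmod p
  have e0 : redEntry g 0 0 = 4 * j' := by
    simp [redEntry, hv, map_ofNat (ZHalf.toZMod p)]
  have e1 : redEntry g 0 1 = -4 * k := by
    simp [redEntry, hv, map_ofNat (ZHalf.toZMod p)]
  rw [delScale, delMult, hn, e0, e1, zpow_natCast, zpow_natCast, pow_one, pow_one]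
  constructor
  · rw [mul_inv_eq_iff_eq_mul₀ h2]
    ring
  · rw [mul_inv_eq_iff_eq_mul₀ (mul_ne_zero h4 h4)]
    ring

/-- The scale from `Δ` is 2j' and the stated one is -2j'; evenness absorbs the sign. Moving L^(-kj)
past the rescaling gives the coefficient kj(2j')² ≡ -kj'. -/
theorem repCocycle_gamma_some {j j' : ℕ} {k : ℤ} {a : (ZMod p)ˣ} (hj : j ≤ p - 1)
    (hj' : j' ≤ p - 1) (h : 4 * (j : ℤ) * j' + 1 = p * k) (ha : (a : ZMod p) = -2 * (j' : ZMod p)) :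
    repCocycle d p lamGamma ((j : ZMod p) : OnePoint (ZMod p)) =
      opS d p a * opL d p ^ (-(k * j)) := by
  obtain ⟨hs, hm⟩ := delScale_delMult_gamma hj hj' h
  have hz := congrArg (fun n : ℤ => (n : ZMod p)) h
  push_cast at hz
  rw [ZMod.natCast_self, zero_mul] at hz
  refine Units.ext (LinearMap.ext fun f => Subtype.ext (funext fun x => ?_))
  rw [repCocycle, delRep_apply, hs, hm, Units.val_mul, Module.End.mul_apply]
  change _ = (((opL d p ^ (-(k * j)) : LinearMap.GeneralLinearGroup ℂ (EvenFun d p)) :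
    EvenFun d p →ₗ[ℂ] EvenFun d p) f).1 (a • x)
  have hax : a • x = -((2 * (j' : ZMod p)) • x) := by
    funext i
    simp only [Pi.smul_apply, Units.smul_def, ha, smul_eq_mul, Pi.neg_apply]
    ring
  rw [opL_zpow_apply, hax, f.2]
  congr 2
  simp only [neg_dotProduct, dotProduct_neg, smul_dotProduct, dotProduct_smul, smul_eq_mul]
  push_cast
  linear_combination (-(k : ZMod p) * j' * (x ⬝ᵥ x)) * hz

end Values

/-! ### The transformation formula -/

section Transformation

variable (d : ℕ) {p : ℕ} [Fact p.Prime]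

/-- The map `Θ(F) = ∑ⱼ θ^j_{F(j)}`. -/
def thetaSum (d p : ℕ) [Fact p.Prime] : (OnePoint (ZMod p) → EvenFun d p) →ₗ[ℂ] Hol :=
  ∑ j, thetaLin d j ∘ₗ LinearMap.proj j

theorem thetaSum_apply (F : OnePoint (ZMod p) → EvenFun d p) :
    thetaSum d p F = ∑ j, thetaLin d j (F j) := by
  simp [thetaSum]

variable [Fact (p ≠ 2)]

theorem exists_dual_index {j : ZMod p} (hj : j ≠ 0) :
    ∃ (j' : ℕ) (k : ℤ), j' ≤ p - 1 ∧ 4 * (j.val : ℤ) * j' + 1 = p * k := by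
  have h4 := four_ne_zero_zmod p
  have hlt := ZMod.val_lt (-(4 * j)⁻¹)
  have hz : ((4 * (j.val : ℤ) * ((-(4 * j)⁻¹).val : ℤ) + 1 : ℤ) : ZMod p) = 0 := by
    push_cast
    rw [ZMod.natCast_zmod_val, ZMod.natCast_zmod_val]
    field_simp
    ring
  obtain ⟨k, hk⟩ := (ZMod.intCast_zmod_eq_zero_iff_dvd _ p).1 hz
  exact ⟨(-(4 * j)⁻¹).val, k, by omega, hk⟩

theorem slash_alpha_theta (j : OnePoint (ZMod p)) (f : EvenFun d p) :
    slash d (weightParam d) lamAlpha (theta j f.1) =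
      theta (lamAlpha • j)
        ((repCocycle d p lamAlpha j : EvenFun d p →ₗ[ℂ] EvenFun d p) f).1 := by
  refine slash_ext fun τ => ?_
  rw [slash_alpha_smul]
  cases j with
  | infty =>
    rw [repCocycle_alpha_infty, lamAlpha_smul_infty]
    exact (theta_alpha_infty f.1 τ).symm
  | coe j =>
    have hlt := ZMod.val_lt j
    obtain ⟨n, hn, rfl⟩ : ∃ n : ℕ, n < p ∧ (n : ZMod p) = j :=
      ⟨j.val, hlt, ZMod.natCast_zmod_val j⟩
    rw [lamAlpha_smul_some]
    by_cases h : n ≤ p - 2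
    · rw [repCocycle_alpha d p h]
      exact (theta_alpha h f.1 τ).symm
    · obtain rfl : n = p - 1 := by omega
      rw [repCocycle_alpha_last, natCast_sub_one_add_one]
      exact (theta_alpha_last f τ).symm

theorem slash_gamma_theta (j : OnePoint (ZMod p)) (f : EvenFun d p) :
    slash d (weightParam d) lamGamma (theta j f.1) =
      theta (lamGamma • j)
        ((repCocycle d p lamGamma j : EvenFun d p →ₗ[ℂ] EvenFun d p) f).1 := by
  refine slash_ext fun τ => ?_
  rw [slash_gamma_smul]
  cases j with
  | infty =>
    rw [repCocycle_gamma_infty, lamGamma_smul_infty]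
    exact (theta_gamma_infty f.1 τ).symm
  | coe j =>
    by_cases hj : j = 0
    · subst hj
      rw [repCocycle_gamma_zero, lamGamma_smul_zero]
      exact (theta_gamma_zero f.1 τ).symm
    · obtain ⟨j', k, hj', h⟩ := exists_dual_index hj
      have hlt := ZMod.val_lt j
      obtain ⟨n, hn, rfl⟩ : ∃ n : ℕ, n < p ∧ (n : ZMod p) = j :=
        ⟨j.val, hlt, ZMod.natCast_zmod_val j⟩
      rw [ZMod.val_cast_of_lt hn] at h
      have hz := congrArg (fun n : ℤ => (n : ZMod p)) h
      push_cast at hz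
      rw [ZMod.natCast_self, zero_mul] at hz
      obtain ⟨hs, hm⟩ := delScale_delMult_gamma (p := p) (by omega) hj' h
      rw [lamGamma_smul_some p hz]
      exact (theta_gamma_some (by omega) hj' h hm hs f τ).symm

/-- The slash action is a representation and σ is a cocycle, so the elements g satisfying the
formula for all j and f form a subgroup; it contains both generators. -/
theorem slashRep_thetaLin (g : Lam) (j : OnePoint (ZMod p)) (f : EvenFun d p) :
    slashRep d (weightParam d) g (thetaLin d j f) =
      thetaLin d (g • j) ((repCocycle d p g j : EvenFun d p →ₗ[ℂ] EvenFun d p) f) := by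
  have hc := isCocycle_repCocycle d p
  refine lam_induction (P := fun g => ∀ (j : OnePoint (ZMod p)) (f : EvenFun d p),
    slashRep d (weightParam d) g (thetaLin d j f) =
      thetaLin d (g • j) ((repCocycle d p g j : EvenFun d p →ₗ[ℂ] EvenFun d p) f))
    (fun j f => Subtype.ext (slash_alpha_theta d j f))
    (fun j f => Subtype.ext (slash_gamma_theta d j f)) ?_ ?_ ?_ g j f
  · intro j f
    rw [map_one, hc.map_one, one_smul]
    rfl
  · intro x y hx hy j f
    rw [map_mul, Module.End.mul_apply, hy, hx, hc, mul_smul]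
    rfl
  · intro x hx j f
    have h1 : repCocycle d p x (x⁻¹ • j) * repCocycle d p x⁻¹ j = 1 := by
      rw [← hc, mul_inv_cancel, hc.map_one]
    -- For x⁻¹, the formula for x is applied at x⁻¹j to σ(x⁻¹, j)f, which x carries back to f.
    have h2 := hx (x⁻¹ • j) ((repCocycle d p x⁻¹ j : EvenFun d p →ₗ[ℂ] EvenFun d p) f)
    rw [smul_inv_smul, ← Module.End.mul_apply (repCocycle d p x (x⁻¹ • j)).val, ← Units.val_mul,
      h1] at h2
    rw [show thetaLin d j f = thetaLin d j ((1 : LinearMap.GeneralLinearGroup ℂ _).val f) from rfl,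
      ← h2, ← Module.End.mul_apply, ← map_mul]
    simp

theorem slashRep_thetaSum (g : Lam) (F : OnePoint (ZMod p) → EvenFun d p) :
    slashRep d (weightParam d) g (thetaSum d p F) =
      thetaSum d p (cocycleRep (repCocycle d p) (isCocycle_repCocycle d p) g F) := by
  rw [thetaSum_apply, thetaSum_apply, map_sum]
  -- The sum over X is re-indexed by the permutation j ↦ gj.
  refine Eq.trans (Finset.sum_congr rfl fun j _ => ?_) (Equiv.sum_comp (MulAction.toPerm g) _)
  rw [slashRep_thetaLin, MulAction.toPerm_apply]
  simp [cocycleRep]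

end Transformation

end

theorem theorem2p13 (d : ℕ) (hd : 0 < d) (p : ℕ) [Fact p.Prime] [Fact (p ≠ 2)] :
    -- the theta series converge absolutely, to holomorphic functions
    (∀ (j : OnePoint (ZMod p)) (f : EvenFun d p),
      (∀ τ : ℍ, Summable (thetaTerm j f.1 τ)) ∧ theta j f.1 ∈ Hol) ∧
    ∃ (φ : Lam → OnePoint (ZMod p) → Del p)
      (π : Del p →* LinearMap.GeneralLinearGroup ℂ (EvenFun d p))
      (σ : Lam → OnePoint (ZMod p) → LinearMap.GeneralLinearGroup ℂ (EvenFun d p))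
      (hσ : IsCocycle σ) (u : ℂ),
      IsCocycle φ ∧
      (∀ g j, σ g j = π (φ g j)) ∧
      -- the transformation formula
      (∀ (g : Lam) (j : OnePoint (ZMod p)) (f : EvenFun d p),
        slash d u g (theta j f.1) =
          theta (g • j) ((σ g j : EvenFun d p →ₗ[ℂ] EvenFun d p) f).1) ∧
      -- the values of `σ` on the generators
      (∀ j : ℕ, j ≤ p - 2 → σ lamAlpha ((j : ZMod p) : OnePoint (ZMod p)) = 1) ∧
      σ lamAlpha (((p - 1 : ℕ) : ZMod p) : OnePoint (ZMod p)) = opL d p ∧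
      σ lamAlpha ∞ = 1 ∧
      σ lamGamma ((0 : ZMod p) : OnePoint (ZMod p)) = 1 ∧
      (∀ (j j' : ℕ) (k : ℤ) (a : (ZMod p)ˣ), 1 ≤ j → j ≤ p - 1 → 1 ≤ j' → j' ≤ p - 1 →
        4 * (j : ℤ) * j' + 1 = p * k → (a : ZMod p) = -2 * (j' : ZMod p) →
        σ lamGamma ((j : ZMod p) : OnePoint (ZMod p)) = opS d p a * opL d p ^ (-(k * j))) ∧
      σ lamGamma ∞ = 1 ∧
      -- the values of `φ` on the generators
      (∀ j : ℕ, j ≤ p - 2 → φ lamAlpha ((j : ZMod p) : OnePoint (ZMod p)) = 1) ∧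
      (φ lamAlpha (((p - 1 : ℕ) : ZMod p) : OnePoint (ZMod p))).1.val = !![1, -4; 0, 1] ∧
      (φ lamAlpha ∞).1.val = !![1, 0; (p : ZHalf), 1] ∧
      (φ lamGamma ((0 : ZMod p) : OnePoint (ZMod p))).1.val = !![-4, 0; 0, -4] ∧
      (∀ (j j' : ℕ) (k : ℤ), 1 ≤ j → j ≤ p - 1 → 1 ≤ j' → j' ≤ p - 1 →
        4 * (j : ℤ) * j' + 1 = p * k →
        (φ lamGamma ((j : ZMod p) : OnePoint (ZMod p))).1.val =
          !![4 * (j' : ZHalf), -4 * (k : ZHalf); (p : ZHalf), -4 * (j : ZHalf)]) ∧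
      φ lamGamma ∞ = 1 ∧
      -- `V_p^X` is induced from the stabilizer of `∞`
      IsInducedFrom (cocycleRep σ hσ)
        (MulAction.stabilizer Lam (∞ : OnePoint (ZMod p))) (supportedAt ∞) ∧
      -- `Θ` is equivariant
      ∃ Θ : (OnePoint (ZMod p) → EvenFun d p) →ₗ[ℂ] Hol,
        (∀ F τ, (Θ F).1 τ = ∑ j, theta j (F j).1 τ) ∧
        ∀ (g : Lam) (F : OnePoint (ZMod p) → EvenFun d p),
          slashRep d u g (Θ F) = Θ (cocycleRep σ hσ g F) := by
  refine ⟨fun j f => ⟨summable_thetaTerm j f.1, theta_mem_Hol j f.1⟩, delCocycle p, delRep d p,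
    repCocycle d p, isCocycle_repCocycle d p, weightParam d, isCocycle_delCocycle p,
    fun g j => rfl, fun g j f => congrArg Subtype.val (slashRep_thetaLin d g j f),
    fun j hj => repCocycle_alpha d p hj, repCocycle_alpha_last d p, repCocycle_alpha_infty d p,
    repCocycle_gamma_zero d p,
    fun j j' k a _ hj _ hj' h ha => repCocycle_gamma_some d hj hj' h ha,
    repCocycle_gamma_infty d p, fun j hj => delCocycle_alpha p hj, delCocycle_alpha_last p,
    delCocycle_alpha_infty p, delCocycle_gamma_zero p,
    fun j j' k _ hj _ hj' h => delCocycle_gamma_some p hj hj' h, delCocycle_gamma_infty p,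
    isInducedFrom_cocycleRep _ ∞, thetaSum d p, fun F τ => ?_, slashRep_thetaSum d⟩
  rw [thetaSum_apply]
  simp [thetaLin]
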